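/- **Setting.** Let $\mathscr S(\mathbb R)$ be the real Schwartz space, $\Omega=\mathscr S(\mathbb R)'$ with its Borel $\sigma$-algebra, and $P$ the white noise measure on $\Omega$, i.e. the probability measure with $\int_\Omega e^{i\langle\omega,s\rangle}dP(\omega)=e^{-\|s\|_{L^2}^2/2}$ for $s\in\mathscr S(\mathbb R)$. Let $\mathcal W=L^2(\Omega,P)$ (real-valued), and let $Q:L^2(\mathbb R)\to\mathcal W$ be the isometry extending $s\mapsto\langle\cdot,s\rangle$ continuously. Let $m:\mathbb R\to[0,\infty)$ be measurable and even, with $m(u)\le K|u|^{-\beta}$ for $0<|u|\le1$ and $m(u)\le K|u|^{2N}$ for $|u|>1$, where $0<K<\infty$, $\beta<2$, $N\in\{0,1,2,\dots\}$. Assume also that the integrals $\int_{\mathbb R}\frac{(e^{iut}-1)(e^{-ius}-1)}{u^2}m(u)\,du$ converge absolutely for all $t,s\in\mathbb R$. Define $T_m$ by $\widehat{T_mf}=\sqrt m\,\widehat f$, where $\widehat f(u)=\int e^{-iux}f(x)\,dx$, on the $f\in L^2(\mathbb R)$ with $\sqrt m\,\widehat f\in L^2(\mathbb R)$. Put $X_m(t)=Q(T_m1_{[0,t]})\in\mathcal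 W$ for $t\in\mathbb R$, with $1_{[0,t]}=-1_{[t,0]}$ for $t<0$. Let $h_n$ be the probabilists' Hermite polynomials, $\eta_k(x)=\pi^{-1/4}((k-1)!)^{-1/2}e^{-x^2/2}h_{k-1}(\sqrt2x)$, $k\ge1$, the Hermite functions, $\ell$ the set of finitely supported sequences $\alpha=(\alpha_1,\alpha_2,\dots)$ in $\{0,1,2,\dots\}$, and $H_\alpha(\omega)=\prod_kh_{\alpha_k}(\langle\omega,\eta_k\rangle)$; the $H_\alpha$ form an orthogonal basis of $\mathcal W$ with $E[H_\alpha^2]=\alpha!$. Write $(2\mathbb N)^{k\alpha}=\prod_j(2j)^{k\alpha_j}$. For $k\ge1$ let $\mathcal H_k$ be the space of $F=\sum f_\alpha H_\alpha$ with $\|F\|_k^2=\sum(\alpha!)^2f_\alpha^2(2\mathbb N)^{k\alpha}<\infty$, and $\mathcal H_k'$ the space of sequences $G=(g_\alpha)_{\alpha\in\ell}$ of real numbers with $\|G\|_k'^2=\sum g_\alpha^2(2\mathbb N)^{-k\alpha}<\infty$. Put $S_1=\bigcap_{k\ge1}\mathcal H_k$ and $S_{-1}=\bigcup_{k\ge1}\mathcal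 H_k'$, with the duality $\langle G,F\rangle=\sum\alpha!f_\alpha g_\alpha$. The strong topology of $S_{-1}$ is that of uniform convergence on the subsets of $S_1$ that are bounded in every norm $\|\cdot\|_k$. Elements of $\mathcal W$ are identified with their coefficient sequences. The Wick product is $(f\lozenge g)_\gamma=\sum_{\alpha+\beta=\gamma}f_\alpha g_\beta$. Finally put $W_m(t)=\sum_{k\ge1}(T_m\eta_k)(t)\,H_{\epsilon^{(k)}}$, where $\epsilon^{(k)}$ is the $k$-th unit sequence and $(T_m\eta_k)(t)=\frac1{2\pi}\int e^{iut}\sqrt{m(u)}\,\widehat{\eta_k}(u)\,du$. **Theorem.** Let $a\le b$ and let $Y:[a,b]\to S_{-1}$ be continuous for the strong topology of $S_{-1}$. Then there is an integer $p\ge1$ such that $t\mapsto Y(t)\lozenge W_m(t)$ is a continuous function from $[a,b]$ to the Hilbert space $\mathcal H_p'$ (so that its integral exists as an $\mathcal H_p'$-valued Riemann integral), the sums below belong to $\mathcal H_p'$, and $$\int_a^bY(t)\lozenge W_m(t)\,dt=\lim_{|\Delta|\to0}\ \sum_{k=0}^{n-1}Y(t_k)\lozenge\bigl(X_m(t_{k+1})-X_m(t_k)\bigr)$$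 in the norm of $\mathcal H_p'$, where $\Delta: a=t_0<t_1<\dots<t_n=b$ runs over the partitions of $[a,b]$ and $|\Delta|=\max_k(t_{k+1}-t_k)$. -/

import Mathlib

noncomputable section

namespace WickIto

open MeasureTheory Filter Topology Polynomial
open scoped SchwartzMap FourierTransform ENNReal

/-! ### Hermite functions -/

/-- The Hermite function number `k + 1`,
`x ↦ π^{-1/4} (k!)^{-1/2} e^{-x²/2} h_k(√2 x)`, where `h_k` is the (probabilists') Hermite
polynomial. Indices are shifted by one throughout: `k : ℕ` stands for the positive integer
`k + 1`. -/
def hermiteFun (k : ℕ) (x : ℝ) : ℝ :=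
  Real.pi ^ (-(1 / 4) : ℝ) * (Real.sqrt (k.factorial : ℝ))⁻¹ * Real.exp (-(x ^ 2 / 2)) *
    aeval (Real.sqrt 2 * x) (hermite k)

theorem bounded_poly_mul_gaussian (q : ℝ[X]) :
    ∃ C : ℝ, ∀ x : ℝ, |q.eval x * Real.exp (-(x ^ 2 / 2))| ≤ C := by
  have hc : Continuous fun x : ℝ => q.eval x * Real.exp (-(x ^ 2 / 2)) := by fun_prop
  have hlim : Tendsto (fun x : ℝ => q.eval x * Real.exp (-(x ^ 2 / 2))) (cocompact ℝ) (𝓝 0) := by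
    have h1 : ∀ n : ℕ, Tendsto (fun x : ℝ => x ^ n * Real.exp (-(x ^ 2 / 2)))
        (cocompact ℝ) (𝓝 0) := by
      intro n
      have h := tendsto_rpow_abs_mul_exp_neg_mul_sq_cocompact (a := 1 / 2) (by norm_num) (n : ℝ)
      refine tendsto_zero_iff_abs_tendsto_zero _ |>.2 (h.congr fun x => ?_)
      simp only [Function.comp, abs_mul, abs_pow, Real.abs_exp, Real.rpow_natCast]
      congr 2
      ring
    have h2 : Tendsto (fun x : ℝ => ∑ i ∈ Finset.range (q.natDegree + 1),
        q.coeff i * (x ^ i * Real.exp (-(x ^ 2 / 2)))) (cocompact ℝ) (𝓝 0) := by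
      have := tendsto_finsetSum (Finset.range (q.natDegree + 1))
        (fun i _ => (h1 i).const_mul (q.coeff i))
      simpa using this
    refine h2.congr fun x => ?_
    rw [Polynomial.eval_eq_sum_range, Finset.sum_mul]
    exact Finset.sum_congr rfl fun i _ => by ring
  obtain ⟨C, hC⟩ := (ZeroAtInftyContinuousMap.isBounded_range
    (⟨⟨_, hc⟩, hlim⟩ : ZeroAtInftyContinuousMap ℝ ℝ)).exists_norm_le
  exact ⟨C, fun x => by simpa using hC _ ⟨x, rfl⟩⟩

theorem iteratedDeriv_poly_mul_gaussian (n : ℕ) (q : ℝ[X]) :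
    ∃ r : ℝ[X], iteratedDeriv n (fun x : ℝ => q.eval x * Real.exp (-(x ^ 2 / 2))) =
      fun x => r.eval x * Real.exp (-(x ^ 2 / 2)) := by
  induction n generalizing q with
  | zero => exact ⟨q, by simp⟩
  | succ n ih =>
    obtain ⟨r, hr⟩ := ih (derivative q - X * q)
    refine ⟨r, ?_⟩
    rw [iteratedDeriv_succ', ← hr]
    congr 1
    funext x
    have h1 : HasDerivAt (fun x : ℝ => Real.exp (-(x ^ 2 / 2)))
        (Real.exp (-(x ^ 2 / 2)) * (-(2 * x / 2))) x := by
      have h0 : HasDerivAt (fun x : ℝ => -(x ^ 2 / 2)) (-(2 * x / 2)) x := by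
        have h := (((hasDerivAt_id x).fun_pow 2).div_const 2).fun_neg
        simpa using h
      exact h0.exp
    rw [((q.hasDerivAt x).fun_mul h1).deriv]
    simp only [eval_sub, eval_mul, eval_X]
    ring

theorem hermiteFun_eq (k : ℕ) : ∃ q : ℝ[X],
    hermiteFun k = fun x => q.eval x * Real.exp (-(x ^ 2 / 2)) := by
  refine ⟨C (Real.pi ^ (-(1 / 4) : ℝ) * (Real.sqrt (k.factorial : ℝ))⁻¹) *
    ((hermite k).map (Int.castRingHom ℝ)).comp (C (Real.sqrt 2) * X), ?_⟩
  funext x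
  simp only [hermiteFun, eval_mul, eval_C, eval_comp, eval_X, aeval_def, eval_map,
    algebraMap_int_eq]
  ring

/-- The Hermite functions as Schwartz functions. -/
def hermiteSchwartz (k : ℕ) : 𝓢(ℝ, ℝ) where
  toFun := hermiteFun k
  smooth' := by
    obtain ⟨q, hq⟩ := hermiteFun_eq k
    rw [hq]
    have h : ContDiff ℝ (⊤ : ℕ∞) fun x : ℝ => q.eval x := by
      simpa using q.contDiff_aeval (𝕜 := ℝ) (⊤ : ℕ∞)
    exact h.mul (by fun_prop)
  decay' := by
    intro j n
    obtain ⟨q, hq⟩ := hermiteFun_eq k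
    obtain ⟨r, hr⟩ := iteratedDeriv_poly_mul_gaussian n q
    obtain ⟨C, hC⟩ := bounded_poly_mul_gaussian (X ^ j * r)
    refine ⟨C, fun x => ?_⟩
    rw [norm_iteratedFDeriv_eq_norm_iteratedDeriv, hq, hr]
    refine le_trans (le_of_eq ?_) (hC x)
    simp only [eval_mul, eval_pow, eval_X, Real.norm_eq_abs, abs_mul, abs_pow]
    ring

/-! ### The operator `T_m` -/

/-- The Fourier transform `f̂(u) = ∫ e^{-iux} f(x) dx` of a real function. -/
def hat (f : ℝ → ℝ) (u : ℝ) : ℂ :=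
  ∫ x : ℝ, Complex.exp (-(Complex.I * u * x)) * (f x : ℂ)

/-- A real `L²` function as a complex one. -/
def toComplexL2 (f : Lp ℝ 2 (volume : Measure ℝ)) : Lp ℂ 2 (volume : Measure ℝ) :=
  Complex.ofRealCLM.compLp f

/-- The function `√m · f̂` for `f ∈ L²(ℝ)`, in the variable `ξ = u / 2π`: Mathlib's Fourier
transform `𝓕` has the kernel `e^{-2πiξx}`, so that `f̂(2πξ) = (𝓕 f)(ξ)`. -/
def symbolMul (m : ℝ → ℝ) (f : Lp ℝ 2 (volume : Measure ℝ)) (ξ : ℝ) : ℂ :=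
  (Real.sqrt (m (2 * Real.pi * ξ)) : ℂ) *
    (𝓕 (toComplexL2 f) : Lp ℂ 2 (volume : Measure ℝ)) ξ

/-- The domain of `T_m` in `L²(ℝ)`: those `f` for which `√m · f̂` is square integrable. -/
def InDomT (m : ℝ → ℝ) (f : Lp ℝ 2 (volume : Measure ℝ)) : Prop :=
  MemLp (symbolMul m f) 2 volume

open scoped Classical in
/-- The operator `T_m` on `L²(ℝ)`, given on its domain by `(T_m f)^ = √m f̂`. For even `m` the
function with this Fourier transform is real, and taking its real part only changes its type. -/
def opT (m : ℝ → ℝ) (f : Lp ℝ 2 (volume : Measure ℝ)) : Lp ℝ 2 (volume : Measure ℝ) :=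
  if h : InDomT m f then
    Complex.reCLM.compLp (𝓕⁻ (MemLp.toLp _ h) : Lp ℂ 2 (volume : Measure ℝ))
  else 0

/-- The value at `t` of the continuous version of `T_m f`, for `f` a Schwartz function:
`(T_m f)(t) = (2π)⁻¹ ∫ e^{iut} √m(u) f̂(u) du` (a real number for even `m`). -/
def opTValue (m : ℝ → ℝ) (f : 𝓢(ℝ, ℝ)) (t : ℝ) : ℝ :=
  ((2 * Real.pi : ℂ)⁻¹ *
    ∫ u : ℝ, Complex.exp (Complex.I * u * t) * (Real.sqrt (m u) : ℂ) * hat f u).re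

/-- The function `1_{[0,t]}` in `L²(ℝ)`, with the usual convention `1_{[0,t]} = -1_{[t,0]}` for
`t < 0`, so that `∫ 1_{[0,t]} f = ∫₀ᵗ f` for all real `t`. -/
def indicatorL2 (t : ℝ) : Lp ℝ 2 (volume : Measure ℝ) :=
  indicatorConstLp 2 (measurableSet_Icc (a := 0) (b := t)) measure_Icc_lt_top.ne (1 : ℝ) -
    indicatorConstLp 2 (measurableSet_Icc (a := t) (b := 0)) measure_Icc_lt_top.ne (1 : ℝ)

/-! ### The white noise space -/

/-- The space `Ω = 𝓢(ℝ)'` of real tempered distributions. -/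
abbrev Omega : Type := StrongDual ℝ 𝓢(ℝ, ℝ)

instance : MeasurableSpace Omega := borel Omega

instance : BorelSpace Omega := ⟨rfl⟩

/-- `P` is the white noise measure: its characteristic functional is `s ↦ e^{-‖s‖²/2}`, with the
`L²` norm of `s`. -/
def IsWhiteNoise (P : Measure Omega) : Prop :=
  IsProbabilityMeasure P ∧ ∀ s : 𝓢(ℝ, ℝ),
    ∫ ω : Omega, Complex.exp (Complex.I * (ω s : ℂ)) ∂P =
      Complex.exp (-((∫ x : ℝ, s x ^ 2 : ℝ) : ℂ) / 2)

open scoped Classical in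
/-- The random variable `Q_s(ω) = ⟨ω, s⟩`, as an element of `L²(P)`. -/
def evalL2 (P : Measure Omega) (s : 𝓢(ℝ, ℝ)) : Lp ℝ 2 P :=
  if h : MemLp (fun ω : Omega => ω s) 2 P then h.toLp _ else 0

/-- The extension by continuity of `s ↦ Q_s` from `𝓢(ℝ)` to `L²(ℝ)`. -/
def Q (P : Measure Omega) (f : Lp ℝ 2 (volume : Measure ℝ)) : Lp ℝ 2 P :=
  limUnder (comap (fun s : 𝓢(ℝ, ℝ) => s.toLp 2 volume) (𝓝 f)) (evalL2 P)

/-- The process `X_m(t) = Q_{T_m 1_{[0,t]}}`. -/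
def X (P : Measure Omega) (m : ℝ → ℝ) (t : ℝ) : Lp ℝ 2 P :=
  Q P (opT m (indicatorL2 t))

/-- Finitely supported sequences of natural numbers. -/
abbrev Multiindex : Type := ℕ →₀ ℕ

/-- `α! = ∏ α_j!`. -/
def mfactorial (α : Multiindex) : ℝ := α.prod fun _ n => (n.factorial : ℝ)

/-- `H_α(ω) = ∏ h_{α_j}(⟨ω, η_j⟩)`, with the Hermite functions `η_j`. -/
def basisH (α : Multiindex) (ω : Omega) : ℝ :=
  α.prod fun j n => aeval (ω (hermiteSchwartz j)) (hermite n)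

/-- The coefficients of `F ∈ L²(P)` in the orthogonal basis `H_α`, for which `E[H_α²] = α!`. -/
def chaosCoeff (P : Measure Omega) (F : Lp ℝ 2 P) (α : Multiindex) : ℝ :=
  (mfactorial α)⁻¹ * ∫ ω, F ω * basisH α ω ∂P

/-! ### Kondratiev spaces

Elements are given by their coefficients with respect to the `H_α`. -/

/-- The weight `(2ℕ)^{pα} = ∏ (2j)^{p α_j}` (with `j + 1` for `j` because of the shift). -/
def weight (p : ℕ) (α : Multiindex) : ℝ :=
  α.prod fun j n => (2 * ((j : ℝ) + 1)) ^ (p * n)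

theorem weight_pos (p : ℕ) (α : Multiindex) : 0 < weight p α :=
  Finset.prod_pos fun j _ => by positivity

/-- The coefficient sequences of the elements of `ℋ_p'`: `∑ g_α² (2ℕ)^{-pα} < ∞`. -/
def InHDual (p : ℕ) (g : Multiindex → ℝ) : Prop :=
  Summable fun α => g α ^ 2 * (weight p α)⁻¹

/-- A stochastic test function, an element of `S_1 = ⋂_{p ≥ 1} ℋ_p`. -/
structure TestFunction where
  coeff : Multiindex → ℝ
  mem : ∀ p : ℕ, 1 ≤ p → Summable fun α => mfactorial α ^ 2 * coeff α ^ 2 * weight p α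

/-- The norm of `ℋ_p` on `S_1`. -/
def TestFunction.pnorm (p : ℕ) (F : TestFunction) : ℝ :=
  Real.sqrt (∑' α, mfactorial α ^ 2 * F.coeff α ^ 2 * weight p α)

/-- A stochastic distribution, an element of `S_{-1} = ⋃_{p ≥ 1} ℋ_p'`. -/
structure StochDist where
  coeff : Multiindex → ℝ
  mem : ∃ p : ℕ, 1 ≤ p ∧ InHDual p coeff

/-- The duality `⟨G, F⟩ = ∑ α! f_α g_α` between `S_{-1}` and `S_1`. -/
def pairing (G : StochDist) (F : TestFunction) : ℝ :=
  ∑' α, mfactorial α * F.coeff α * G.coeff α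

/-- The bounded subsets of `S_1`. -/
def boundedSets : Set (Set TestFunction) :=
  {B | ∀ p : ℕ, 1 ≤ p → ∃ C : ℝ, ∀ F ∈ B, F.pnorm p ≤ C}

/-- The strong topology of `S_{-1} = S_1'`: uniform convergence on bounded subsets of `S_1`. -/
instance : TopologicalSpace StochDist :=
  TopologicalSpace.induced
    (fun G => UniformOnFun.ofFun boundedSets (fun F => pairing G F)) inferInstance

/-- The Wick product in coordinates, that is, `H_α ◇ H_β = H_{α+β}` extended bilinearly. -/
def wick (f g : Multiindex → ℝ) (γ : Multiindex) : ℝ :=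
  ∑ x ∈ Finset.HasAntidiagonal.antidiagonal γ, f x.1 * g x.2

/-- `W_m(t) = ∑_k (T_m η_k)(t) H_{ε(k)}`, where `ε(k)` is the `k`-th unit sequence. -/
def W (m : ℝ → ℝ) (t : ℝ) (α : Multiindex) : ℝ :=
  ∑ k ∈ α.support, if α = Finsupp.single k 1 then opTValue m (hermiteSchwartz k) t else 0

/-! ### `ℋ_p'` as a normed space -/

/-- `InHDual p g` says that `α ↦ g_α (2ℕ)^{-pα/2}` is in `ℓ²`. -/
theorem inHDual_iff (p : ℕ) (g : Multiindex → ℝ) :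
    InHDual p g ↔ Memℓp (fun α => g α * (Real.sqrt (weight p α))⁻¹) 2 := by
  rw [memℓp_gen_iff (by norm_num), InHDual]
  refine summable_congr fun α => ?_
  have := (weight_pos p α).le
  simp [mul_pow, Real.sq_sqrt this]

/-- The vector space `ℋ_p'`. -/
def HDual (p : ℕ) : Type :=
  ({ carrier := {g | InHDual p g}
     zero_mem' := by simp [InHDual, summable_zero]
     add_mem' := by
       intro f g hf hg
       simp only [Set.mem_ofPred_eq, inHDual_iff] at *
       convert hf.add hg using 1
       funext α
       simp [add_mul]
     smul_mem' := by
       intro c f hf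
       simp only [Set.mem_ofPred_eq, inHDual_iff] at *
       convert hf.const_smul c using 1
       funext α
       simp [mul_assoc] } : Submodule ℝ (Multiindex → ℝ))

instance (p : ℕ) : AddCommGroup (HDual p) := by unfold HDual; infer_instance

instance (p : ℕ) : Module ℝ (HDual p) := by unfold HDual; infer_instance

/-- The coefficient sequence of an element of `ℋ_p'`. -/
def HDual.coeff {p : ℕ} (g : HDual p) : Multiindex → ℝ := g.1

theorem HDual.inHDual {p : ℕ} (g : HDual p) : InHDual p g.coeff := g.2

/-- The linear map `g ↦ (g_α (2ℕ)^{-pα/2})_α` from `ℋ_p'` to `ℓ²`. -/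
def HDual.toEll2 (p : ℕ) : HDual p →ₗ[ℝ] lp (fun _ : Multiindex => ℝ) 2 where
  toFun g := ⟨fun α => g.coeff α * (Real.sqrt (weight p α))⁻¹, (inHDual_iff p _).1 g.inHDual⟩
  map_add' f g := by
    ext α
    exact add_mul (f.coeff α) (g.coeff α) _
  map_smul' c g := by
    ext α
    exact mul_assoc c (g.coeff α) _

theorem HDual.toEll2_injective (p : ℕ) : Function.Injective (HDual.toEll2 p) := by
  intro f g h
  refine Subtype.ext (funext fun α => ?_)
  have h1 : f.coeff α * (Real.sqrt (weight p α))⁻¹ = g.coeff α * (Real.sqrt (weight p α))⁻¹ :=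
    congrFun (congrArg Subtype.val h) α
  have h2 : (Real.sqrt (weight p α))⁻¹ ≠ 0 :=
    inv_ne_zero (Real.sqrt_pos.2 (weight_pos p α)).ne'
  exact mul_right_cancel₀ h2 h1

/-- The norm `‖g‖_p' = (∑ g_α² (2ℕ)^{-pα})^{1/2}`; see `HDual.norm_eq`. -/
instance (p : ℕ) : NormedAddCommGroup (HDual p) :=
  NormedAddCommGroup.induced (HDual p) (lp (fun _ : Multiindex => ℝ) 2) (HDual.toEll2 p)
    (HDual.toEll2_injective p)

instance (p : ℕ) : NormedSpace ℝ (HDual p) :=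
  NormedSpace.induced ℝ (HDual p) (lp (fun _ : Multiindex => ℝ) 2) (HDual.toEll2 p)

theorem HDual.norm_eq {p : ℕ} (g : HDual p) :
    ‖g‖ = Real.sqrt (∑' α, g.coeff α ^ 2 * (weight p α)⁻¹) := by
  have h : ‖g‖ = ‖HDual.toEll2 p g‖ := rfl
  rw [h, lp.norm_eq_tsum_rpow (by norm_num), Real.sqrt_eq_rpow]
  norm_num
  congr 1
  refine tsum_congr fun α => ?_
  change (g.coeff α * (Real.sqrt (weight p α))⁻¹) ^ 2 = _
  rw [mul_pow, inv_pow, Real.sq_sqrt (weight_pos p α).le]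

instance (p : ℕ) : CompleteSpace (HDual p) := by
  have hiso : Isometry (HDual.toEll2 p) := AddMonoidHomClass.isometry_of_norm _ fun _ => rfl
  have hsurj : Function.Surjective (HDual.toEll2 p) := by
    intro x
    have hx : ∀ α, x α * Real.sqrt (weight p α) * (Real.sqrt (weight p α))⁻¹ = x α := fun α =>
      mul_inv_cancel_right₀ (Real.sqrt_pos.2 (weight_pos p α)).ne' _
    refine ⟨⟨fun α => x α * Real.sqrt (weight p α), ?_⟩, ?_⟩
    · refine (inHDual_iff p _).2 ?_
      simp only [hx]
      exact x.2
    · ext α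
      exact hx α
  exact (IsometryEquiv.mk (Equiv.ofBijective _ ⟨hiso.injective, hsurj⟩) hiso).completeSpace

end WickIto

end

noncomputable section

namespace WickIto

open MeasureTheory Filter Topology Polynomial ProbabilityTheory
open scoped SchwartzMap FourierTransform ENNReal NNReal

/-! ### Hermite polynomials and the Gaussian measure -/

/-! The argument is coefficientwise, followed by a uniform tail estimate. The increment of `X` over
[s,t] has only first order chaos coefficients, and the one at ε(k) is the integral of T_m η_k over
[s,t] (`chaosCoeff_X_sub`); formally, X_m' = W_m. Hence Y(t_k) ◇ (X_m(t_{k+1}) - X_m(t_k)) is the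
integral of Y(t_k) ◇ W_m(s) over [t_k, t_{k+1}], and the error of the Riemann sum is the integral of
(Y(s) - Y(t_k)) ◇ W_m(s). At a fixed γ the Wick product is a finite sum of continuous functions of
the two times, so uniform continuity makes this error small with the mesh
(`exists_delta_of_continuousOn`).

The passage to the norm of ℋ_p' rests on bounds |g_γ| ≤ C (2ℕ)^{qγ} that are uniform in time and in
the partition. Since ∑ (2ℕ)^{-2γ} converges (`summable_weight_inv`), such bounds make the tail of
the norm uniformly small, and only finitely many γ matter (`HDual.exists_finset_norm_lt`). For Y the
bound follows from strong continuity on a compact interval (`exists_abs_coeff_le`): otherwise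
suitable multiples of the H_α would form a bounded set on which the pairings with Y are unbounded.
For W_m it is the polynomial growth in k of T_m η_k (`exists_abs_opTValue_le`), obtained from the
ladder relation of the Hermite functions and the growth conditions on m. The Wick product preserves
such bounds (`abs_wick_le`).

The formula for the increments combines Gaussian calculus for Q (`chaosCoeff_Q`) with Parseval and
Fubini for T_m (`integral_opT_indicatorL2_mul`). -/

/-- The Hermite polynomials with real coefficients. -/
def hermiteReal (n : ℕ) : ℝ[X] := (hermite n).map (Int.castRingHom ℝ)

theorem aeval_hermite (n : ℕ) (x : ℝ) : aeval x (hermite n) = (hermiteReal n).eval x := by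
  simp [hermiteReal, aeval_def, eval_map]

theorem hermiteReal_zero : hermiteReal 0 = 1 := by simp [hermiteReal]

theorem hermiteReal_one : hermiteReal 1 = Polynomial.X := by simp [hermiteReal]

theorem hermiteReal_succ (n : ℕ) :
    hermiteReal (n + 1) = Polynomial.X * hermiteReal n - derivative (hermiteReal n) := by
  simp [hermiteReal, hermite_succ, derivative_map]

theorem derivative_hermiteReal_succ (n : ℕ) :
    derivative (hermiteReal (n + 1)) = ((n : ℝ[X]) + 1) * hermiteReal n := by
  induction n with
  | zero => simp [hermiteReal_one, hermiteReal_zero]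
  | succ n ih =>
    have h : derivative ((n : ℝ[X]) + 1) = 0 := by simp
    rw [hermiteReal_succ (n + 1), derivative_sub, derivative_mul, ih, derivative_mul, h,
      derivative_X, hermiteReal_succ n]
    push_cast
    ring

theorem derivative_hermiteReal (n : ℕ) :
    derivative (hermiteReal n) = (n : ℝ[X]) * hermiteReal (n - 1) := by
  cases n with
  | zero => simp [hermiteReal_zero]
  | succ n => simp [derivative_hermiteReal_succ]

theorem integrable_eval_gaussianReal (v : ℝ≥0) (q : ℝ[X]) :
    Integrable (fun x => q.eval x) (gaussianReal 0 v) := by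
  induction q using Polynomial.induction_on' with
  | add p q hp hq =>
    simp only [eval_add]
    exact hp.add hq
  | monomial n c =>
    simp only [eval_monomial]
    refine Integrable.const_mul ?_ c
    have h : Integrable (fun x : ℝ => ‖x‖ ^ n) (gaussianReal 0 v) :=
      (memLp_id_gaussianReal (μ := 0) (v := v) (n : ℝ≥0)).integrable_norm_pow'
    refine h.mono' (by fun_prop) (ae_of_all _ fun x => ?_)
    rw [norm_pow]

theorem memLp_eval_gaussianReal (v : ℝ≥0) (q : ℝ[X]) :
    MemLp (fun x => q.eval x) 2 (gaussianReal 0 v) := by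
  have hm : AEStronglyMeasurable (fun x => q.eval x) (gaussianReal 0 v) :=
    q.continuous.aestronglyMeasurable
  rw [memLp_two_iff_integrable_sq hm]
  exact (integrable_eval_gaussianReal v (q ^ 2)).congr (ae_of_all _ fun x => eval_pow 2)

theorem gaussianPDFReal_zero_one (x : ℝ) :
    gaussianPDFReal 0 1 x = (Real.sqrt (2 * Real.pi))⁻¹ * Real.exp (-(x ^ 2 / 2)) := by
  simp [gaussianPDFReal, neg_div]

theorem integral_gaussianReal_zero_one (f : ℝ → ℝ) :
    ∫ x, f x ∂(gaussianReal 0 1) =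
      (Real.sqrt (2 * Real.pi))⁻¹ * ∫ x, f x * Real.exp (-(x ^ 2 / 2)) := by
  rw [integral_gaussianReal_eq_integral_smul one_ne_zero, ← integral_const_mul]
  refine integral_congr_ae (ae_of_all _ fun x => ?_)
  simp only [gaussianPDFReal_zero_one, smul_eq_mul]
  ring

theorem hasDerivAt_gaussian (x : ℝ) : HasDerivAt (fun x : ℝ => Real.exp (-(x ^ 2 / 2)))
    (-x * Real.exp (-(x ^ 2 / 2))) x := by
  have h0 : HasDerivAt (fun x : ℝ => -(x ^ 2 / 2)) (-x) x := by
    have h := (((hasDerivAt_id x).fun_pow 2).div_const 2).fun_neg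
    simpa using h
  convert h0.exp using 1
  ring

theorem integrable_eval_mul_gaussian (q : ℝ[X]) :
    Integrable (fun x : ℝ => q.eval x * Real.exp (-(x ^ 2 / 2))) := by
  obtain ⟨C, hC⟩ := bounded_poly_mul_gaussian ((1 + Polynomial.X ^ 2) * q)
  refine (integrable_inv_one_add_sq.const_mul C).mono'
    (by have := q.continuous; exact Continuous.aestronglyMeasurable (by fun_prop))
    (ae_of_all _ fun x => ?_)
  have h1 : 0 < 1 + x ^ 2 := by positivity
  have := hC x
  rw [eval_mul, mul_assoc, abs_mul] at this
  simp only [eval_add, eval_one, eval_pow, eval_X, abs_of_pos h1] at this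
  rw [← div_eq_mul_inv, le_div_iff₀ h1, Real.norm_eq_abs]
  linarith

/-- Stein's identity for polynomials. -/
theorem integral_X_mul_gaussianReal (q : ℝ[X]) :
    ∫ x, (Polynomial.X * q).eval x ∂(gaussianReal 0 1) =
      ∫ x, (derivative q).eval x ∂(gaussianReal 0 1) := by
  rw [integral_gaussianReal_zero_one, integral_gaussianReal_zero_one]
  congr 1
  have hd : ∀ x : ℝ, HasDerivAt (fun x : ℝ => q.eval x * Real.exp (-(x ^ 2 / 2)))
      ((derivative q - Polynomial.X * q).eval x * Real.exp (-(x ^ 2 / 2))) x := by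
    intro x
    refine ((q.hasDerivAt x).fun_mul (hasDerivAt_gaussian x)).congr_deriv ?_
    simp only [eval_sub, eval_mul, eval_X]
    ring
  -- The derivative of q e^{-x²/2} integrates to zero over the line.
  have h := integral_eq_zero_of_hasDerivAt_of_integrable hd (integrable_eval_mul_gaussian _)
    (integrable_eval_mul_gaussian _)
  simp only [eval_sub, sub_mul] at h
  rw [integral_sub (integrable_eval_mul_gaussian _) (integrable_eval_mul_gaussian _)] at h
  linarith

/-- The expectation of a polynomial under the standard Gaussian measure. -/
def gaussE (q : ℝ[X]) : ℝ := ∫ x, q.eval x ∂(gaussianReal 0 1)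

theorem gaussE_add (p q : ℝ[X]) : gaussE (p + q) = gaussE p + gaussE q := by
  simp only [gaussE, eval_add]
  exact integral_add (integrable_eval_gaussianReal 1 p) (integrable_eval_gaussianReal 1 q)

theorem gaussE_sub (p q : ℝ[X]) : gaussE (p - q) = gaussE p - gaussE q := by
  simp only [gaussE, eval_sub]
  exact integral_sub (integrable_eval_gaussianReal 1 p) (integrable_eval_gaussianReal 1 q)

theorem gaussE_natCast_mul (n : ℕ) (q : ℝ[X]) : gaussE ((n : ℝ[X]) * q) = n * gaussE q := by
  simp only [gaussE, eval_mul, eval_natCast]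
  exact integral_const_mul _ _

theorem gaussE_one : gaussE 1 = 1 := by simp [gaussE]

theorem gaussE_X_mul (q : ℝ[X]) : gaussE (Polynomial.X * q) = gaussE (derivative q) :=
  integral_X_mul_gaussianReal q

/-- By Stein's identity, f ↦ X f - f' is the Gaussian adjoint of differentiation, and it raises h_n
to h_{n+1}. -/
theorem gaussE_hermiteReal_succ_mul (n : ℕ) (q : ℝ[X]) :
    gaussE (hermiteReal (n + 1) * q) = gaussE (hermiteReal n * derivative q) := by
  rw [hermiteReal_succ, sub_mul, mul_assoc, gaussE_sub, gaussE_X_mul, derivative_mul, gaussE_add]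
  ring

theorem gaussE_hermiteReal_mul (n k : ℕ) :
    gaussE (hermiteReal n * hermiteReal k) = if n = k then (n.factorial : ℝ) else 0 := by
  induction n generalizing k with
  | zero =>
    cases k with
    | zero => simp [hermiteReal_zero, gaussE_one]
    | succ k =>
      rw [mul_comm, gaussE_hermiteReal_succ_mul]
      simp [hermiteReal_zero, gaussE]
  | succ n ih =>
    rw [gaussE_hermiteReal_succ_mul]
    cases k with
    | zero => simp [hermiteReal_zero, gaussE]
    | succ k =>
      have h : hermiteReal n * derivative (hermiteReal (k + 1)) =
          ((k + 1 : ℕ) : ℝ[X]) * (hermiteReal n * hermiteReal k) := by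
        rw [derivative_hermiteReal_succ]
        push_cast
        ring
      rw [h, gaussE_natCast_mul, ih]
      by_cases hnk : n = k
      · subst hnk
        simp [Nat.factorial_succ]
      · simp [hnk]

theorem gaussE_hermiteReal (n : ℕ) : gaussE (hermiteReal n) = if n = 0 then 1 else 0 := by
  have h := gaussE_hermiteReal_mul n 0
  rw [hermiteReal_zero, mul_one] at h
  rw [h]
  split_ifs with hn <;> simp [hn]

theorem gaussE_X_mul_hermiteReal (n : ℕ) :
    gaussE (Polynomial.X * hermiteReal n) = if n = 1 then 1 else 0 := by
  have h := gaussE_hermiteReal_mul 1 n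
  rw [hermiteReal_one] at h
  rw [h]
  by_cases hn : n = 1 <;> simp [hn, eq_comm]

theorem X_mul_hermiteReal (n : ℕ) : Polynomial.X * hermiteReal n =
    hermiteReal (n + 1) + (n : ℝ[X]) * hermiteReal (n - 1) := by
  rw [hermiteReal_succ, derivative_hermiteReal]
  ring

/-- By the three-term recursion and orthogonality the value is (n+1)! + n² (n-1)!. It gives the
second moment of the Hermite functions. -/
theorem gaussE_X_mul_hermiteReal_sq (n : ℕ) :
    gaussE ((Polynomial.X * hermiteReal n) * (Polynomial.X * hermiteReal n)) =
      (2 * n + 1) * n.factorial := by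
  rw [X_mul_hermiteReal]
  have h : (hermiteReal (n + 1) + (n : ℝ[X]) * hermiteReal (n - 1)) *
      (hermiteReal (n + 1) + (n : ℝ[X]) * hermiteReal (n - 1)) =
      hermiteReal (n + 1) * hermiteReal (n + 1) +
      ((n : ℝ[X]) * (hermiteReal (n + 1) * hermiteReal (n - 1)) +
      ((n : ℝ[X]) * (hermiteReal (n + 1) * hermiteReal (n - 1)) +
      (n : ℝ[X]) * ((n : ℝ[X]) * (hermiteReal (n - 1) * hermiteReal (n - 1))))) := by ring
  rw [h]
  simp only [gaussE_add, gaussE_natCast_mul, gaussE_hermiteReal_mul]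
  cases n with
  | zero => simp
  | succ n =>
    have : n + 1 + 1 ≠ n := by omega
    simp only [Nat.add_sub_cancel, this, if_true, if_false, Nat.factorial_succ]
    push_cast
    ring

/-! ### Hermite functions -/

/-- The substitution y = √2 x turns e^{-x²} into the Gaussian weight; π^{-1/2} and the Jacobian
2^{-1/2} combine to its normalization. -/
theorem hermiteFun_mul_integral (j k : ℕ) (q : ℝ[X]) :
    ∫ x, hermiteFun j x * hermiteFun k x * q.eval (Real.sqrt 2 * x) =
      (Real.sqrt (j.factorial : ℝ))⁻¹ * (Real.sqrt (k.factorial : ℝ))⁻¹ *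
        gaussE (hermiteReal j * hermiteReal k * q) := by
  have hpi := Real.pi_pos
  have h1 : ∀ x, hermiteFun j x * hermiteFun k x * q.eval (Real.sqrt 2 * x) =
      (Real.pi ^ (-(1 / 4) : ℝ) * Real.pi ^ (-(1 / 4) : ℝ) *
        ((Real.sqrt (j.factorial : ℝ))⁻¹ * (Real.sqrt (k.factorial : ℝ))⁻¹)) *
      (fun y : ℝ => (hermiteReal j * hermiteReal k * q).eval y * Real.exp (-(y ^ 2 / 2)))
        (Real.sqrt 2 * x) := by
    intro x
    have h2 : Real.exp (-((Real.sqrt 2 * x) ^ 2 / 2)) =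
        Real.exp (-(x ^ 2 / 2)) * Real.exp (-(x ^ 2 / 2)) := by
      rw [← Real.exp_add, mul_pow, Real.sq_sqrt (by norm_num)]
      congr 1
      ring
    simp only [hermiteFun, aeval_hermite, h2, eval_mul]
    ring
  simp only [h1]
  rw [integral_const_mul, Measure.integral_comp_mul_left
    (fun y : ℝ => (hermiteReal j * hermiteReal k * q).eval y * Real.exp (-(y ^ 2 / 2))), gaussE, integral_gaussianReal_zero_one]
  have h3 : Real.pi ^ (-(1 / 4) : ℝ) * Real.pi ^ (-(1 / 4) : ℝ) = (Real.sqrt Real.pi)⁻¹ := by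
    rw [← Real.rpow_add hpi, Real.sqrt_eq_rpow, ← Real.rpow_neg hpi.le]
    norm_num
  rw [h3, abs_of_pos (by positivity), Real.sqrt_mul (by norm_num), mul_inv, smul_eq_mul]
  ring

theorem integral_hermiteFun_mul (j k : ℕ) :
    ∫ x, hermiteFun j x * hermiteFun k x = if j = k then 1 else 0 := by
  have h := hermiteFun_mul_integral j k 1
  simp only [eval_one, mul_one, gaussE_hermiteReal_mul] at h
  rw [h]
  split_ifs with hjk
  · subst hjk
    have hf : (0 : ℝ) < j.factorial := by exact_mod_cast j.factorial_pos
    rw [← mul_inv, Real.mul_self_sqrt hf.le, inv_mul_cancel₀ hf.ne']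
  · simp

theorem integral_sq_mul_hermiteFun_sq (k : ℕ) :
    ∫ x, x ^ 2 * hermiteFun k x ^ 2 = k + 1 / 2 := by
  have h := hermiteFun_mul_integral k k (Polynomial.X ^ 2)
  have h1 : hermiteReal k * hermiteReal k * Polynomial.X ^ 2 =
    (Polynomial.X * hermiteReal k) * (Polynomial.X * hermiteReal k) := by ring
  have hf : (0 : ℝ) < k.factorial := by exact_mod_cast k.factorial_pos
  rw [h1, gaussE_X_mul_hermiteReal_sq, ← mul_inv, Real.mul_self_sqrt hf.le] at h
  have h2 : ∀ x, hermiteFun k x * hermiteFun k x * (Polynomial.X ^ 2).eval (Real.sqrt 2 * x) =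
      2 * (x ^ 2 * hermiteFun k x ^ 2) := by
    intro x
    simp only [eval_pow, eval_X, mul_pow, Real.sq_sqrt (show (0 : ℝ) ≤ 2 by norm_num)]
    ring
  simp only [h2, integral_const_mul] at h
  field_simp at h
  linarith

theorem hermiteFun_mul_sqrt (k : ℕ) (x : ℝ) :
    hermiteFun (k + 1) x * Real.sqrt (k + 1) = Real.pi ^ (-(1 / 4) : ℝ) *
      (Real.sqrt (k.factorial : ℝ))⁻¹ * Real.exp (-(x ^ 2 / 2)) *
        (hermiteReal (k + 1)).eval (Real.sqrt 2 * x) := by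
  have h : (0 : ℝ) < Real.sqrt ((k : ℝ) + 1) := by positivity
  rw [hermiteFun, aeval_hermite, Nat.factorial_succ]
  push_cast
  rw [Real.sqrt_mul (by positivity), mul_inv]
  field_simp

/-- The ladder relation. For k = 0 the truncated index k - 1 is harmless, since its coefficient √k
vanishes. -/
theorem hasDerivAt_hermiteFun (k : ℕ) (x : ℝ) : HasDerivAt (hermiteFun k)
    ((Real.sqrt 2)⁻¹ * (Real.sqrt k * hermiteFun (k - 1) x -
      Real.sqrt (k + 1) * hermiteFun (k + 1) x)) x := by
  have h2 : (0 : ℝ) < Real.sqrt 2 := by positivity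
  have h22 : Real.sqrt 2 * Real.sqrt 2 = 2 := Real.mul_self_sqrt (by norm_num)
  have hp : HasDerivAt (fun x : ℝ => (hermiteReal k).eval (Real.sqrt 2 * x))
      ((derivative (hermiteReal k)).eval (Real.sqrt 2 * x) * Real.sqrt 2) x := by
    have h0 : HasDerivAt (fun x : ℝ => Real.sqrt 2 * x) (Real.sqrt 2) x := by
      simpa using (hasDerivAt_id x).const_mul (Real.sqrt 2)
    exact ((hermiteReal k).hasDerivAt (Real.sqrt 2 * x)).comp x h0
  set c : ℝ := Real.pi ^ (-(1 / 4) : ℝ) * (Real.sqrt (k.factorial : ℝ))⁻¹ with hc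
  have h := ((hasDerivAt_gaussian x).const_mul c).fun_mul hp
  have hfun : hermiteFun k = fun x => c * Real.exp (-(x ^ 2 / 2)) *
      (hermiteReal k).eval (Real.sqrt 2 * x) := by
    funext x
    rw [hermiteFun, aeval_hermite]
  have hX := congrArg (fun q : ℝ[X] => q.eval (Real.sqrt 2 * x)) (X_mul_hermiteReal k)
  simp only [eval_add, eval_mul, eval_X, eval_natCast] at hX
  have hdown : Real.sqrt k * hermiteFun (k - 1) x = c * Real.exp (-(x ^ 2 / 2)) *
      (k * (hermiteReal (k - 1)).eval (Real.sqrt 2 * x)) := by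
    cases k with
    | zero => simp
    | succ k =>
      rw [hc, hermiteFun, aeval_hermite, Nat.factorial_succ]
      push_cast
      have h3 : (0 : ℝ) < Real.sqrt ((k : ℝ) + 1) := by positivity
      have h4 : Real.sqrt ((k : ℝ) + 1) * Real.sqrt ((k : ℝ) + 1) = k + 1 :=
        Real.mul_self_sqrt (by positivity)
      rw [Real.sqrt_mul (by positivity), mul_inv]
      field_simp
      rw [pow_two, h4]
  rw [hfun]
  refine h.congr_deriv ?_
  rw [hdown, mul_comm (Real.sqrt (k + 1)), hermiteFun_mul_sqrt, ← hc,
    derivative_hermiteReal, eval_mul, eval_natCast]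
  set A := (hermiteReal (k - 1)).eval (Real.sqrt 2 * x)
  set B := (hermiteReal (k + 1)).eval (Real.sqrt 2 * x)
  set D := (hermiteReal k).eval (Real.sqrt 2 * x)
  set e := Real.exp (-(x ^ 2 / 2))
  have hB : B = Real.sqrt 2 * x * D - k * A := by linarith
  rw [hB]
  field_simp
  linear_combination c * e * k * A * h22

theorem integrable_hermiteFun (k : ℕ) : Integrable (hermiteFun k) :=
  (hermiteSchwartz k).integrable

/-- The `L¹` norm of the Hermite functions grows at most linearly. -/
theorem integral_abs_hermiteFun_le (k : ℕ) :
    ∫ x, |hermiteFun k x| ≤ (Real.pi + 2) * (k + 1) := by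
  obtain ⟨q, hq⟩ := hermiteFun_eq k
  have hint : ∀ r : ℝ[X], Integrable fun x => r.eval x * hermiteFun k x ^ 2 := by
    intro r
    have h := (integrable_eval_mul_gaussian (r * q * q)).bdd_mul (c := 1)
      (f := fun x : ℝ => Real.exp (-(x ^ 2 / 2)))
      (Continuous.aestronglyMeasurable (by fun_prop))
      (ae_of_all _ fun x => by
        rw [Real.norm_eq_abs, Real.abs_exp, Real.exp_le_one_iff]
        nlinarith [sq_nonneg x])
    refine h.congr (ae_of_all _ fun x => ?_)
    simp only [hq, eval_mul]
    ring
  have h0 : Integrable fun x => hermiteFun k x ^ 2 := by simpa using hint 1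
  have h2 : Integrable fun x => x ^ 2 * hermiteFun k x ^ 2 := by
    exact (hint (Polynomial.X ^ 2)).congr (ae_of_all _ fun x => by simp only [eval_pow, eval_X])
  -- With z = (1 + x²)|y| this is z ≤ 1 + z² divided by 1 + x². It bounds the L¹ norm by π plus the
  -- L² norms squared of η and xη.
  have hle : ∀ x, |hermiteFun k x| ≤
      (1 + x ^ 2)⁻¹ + (hermiteFun k x ^ 2 + x ^ 2 * hermiteFun k x ^ 2) := by
    intro x
    set y := hermiteFun k x
    have h1 : 0 < 1 + x ^ 2 := by positivity
    have h3 : (1 + x ^ 2)⁻¹ + (y ^ 2 + x ^ 2 * y ^ 2) - |y| =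
        (1 + x ^ 2)⁻¹ * (((1 + x ^ 2) * |y| - 1 / 2) ^ 2 + 3 / 4) := by
      field_simp
      rw [← sq_abs y]
      ring
    have h4 : 0 ≤ (1 + x ^ 2)⁻¹ * (((1 + x ^ 2) * |y| - 1 / 2) ^ 2 + 3 / 4) := by positivity
    linarith
  have hsum := integral_mono (integrable_hermiteFun k).abs
    (integrable_inv_one_add_sq.add (h0.add h2)) hle
  have e0 : ∫ x, hermiteFun k x ^ 2 = 1 := by
    simpa [pow_two] using integral_hermiteFun_mul k k
  have e1 : ∫ x, ((fun x : ℝ => (1 + x ^ 2)⁻¹) + ((fun x : ℝ => hermiteFun k x ^ 2) +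
      (fun x : ℝ => x ^ 2 * hermiteFun k x ^ 2)) : ℝ → ℝ) x = Real.pi + (1 + (k + 1 / 2)) := by
    rw [integral_add' integrable_inv_one_add_sq (h0.add h2), integral_add' h0 h2, e0,
      integral_sq_mul_hermiteFun_sq, integral_univ_inv_one_add_sq]
  refine hsum.trans (e1.le.trans ?_)
  have := Real.pi_pos
  have hk : (0 : ℝ) ≤ k := Nat.cast_nonneg k
  nlinarith

/-! ### Fourier transforms of Hermite functions -/

theorem norm_exp_I_mul_mul (u x : ℝ) : ‖Complex.exp (Complex.I * u * x)‖ = 1 := by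
  have h : Complex.I * (u : ℂ) * (x : ℂ) = ((u * x : ℝ) : ℂ) * Complex.I := by
    push_cast; ring
  rw [h, Complex.norm_exp_ofReal_mul_I]

theorem norm_exp_neg_I_mul_mul (u x : ℝ) : ‖Complex.exp (-(Complex.I * u * x))‖ = 1 := by
  have h : -(Complex.I * (u : ℂ) * (x : ℂ)) = Complex.I * u * ((-x : ℝ) : ℂ) := by
    push_cast; ring
  rw [h, norm_exp_I_mul_mul]

theorem integrable_exp_mul {f : ℝ → ℝ} (hf : Integrable f) (u : ℝ) :
    Integrable fun x : ℝ => Complex.exp (-(Complex.I * u * x)) * (f x : ℂ) :=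
  hf.ofReal.bdd_mul (c := 1) (Continuous.aestronglyMeasurable (by fun_prop))
    (ae_of_all _ fun x => (norm_exp_neg_I_mul_mul u x).le)

theorem norm_hat_le {f : ℝ → ℝ} (u : ℝ) : ‖hat f u‖ ≤ ∫ x, |f x| := by
  refine (norm_integral_le_integral_norm _).trans_eq (integral_congr_ae (ae_of_all _ fun x => ?_))
  simp only [norm_mul, norm_exp_neg_I_mul_mul, Complex.norm_real, Real.norm_eq_abs, one_mul]

theorem continuous_hat {f : ℝ → ℝ} (hf : Integrable f) : Continuous (hat f) := by
  refine continuous_of_dominated (bound := fun x => |f x|)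
    (fun u => (integrable_exp_mul hf u).aestronglyMeasurable)
    (fun u => ae_of_all _ fun x => ?_) hf.abs (ae_of_all _ fun x => by fun_prop)
  simp only [norm_mul, norm_exp_neg_I_mul_mul, Complex.norm_real, Real.norm_eq_abs, one_mul, le_refl]

theorem integral_linear_comb {f g h : ℝ → ℂ} (hf : Integrable f) (hg : Integrable g)
    (hh : Integrable h) (a b c d : ℂ) : ∫ x, a * (b * f x - c * g x) - d * h x =
      a * (b * (∫ x, f x) - c * ∫ x, g x) - d * ∫ x, h x := by
  have h1 : Integrable fun x => b * f x - c * g x := (hf.const_mul b).sub (hg.const_mul c)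
  rw [integral_sub (h1.const_mul a) (hh.const_mul d), integral_const_mul, integral_const_mul,
    integral_sub (hf.const_mul b) (hg.const_mul c), integral_const_mul, integral_const_mul]

/-- The derivative of e^{-iux} η_k(x) has integral zero; the ladder relation expresses η_k' by the
two neighbours. -/
theorem mul_hat_hermiteFun (k : ℕ) (u : ℝ) :
    Complex.I * u * hat (hermiteFun k) u = ((Real.sqrt 2)⁻¹ : ℝ) *
      ((Real.sqrt k : ℝ) * hat (hermiteFun (k - 1)) u -
        (Real.sqrt (k + 1) : ℝ) * hat (hermiteFun (k + 1)) u) := by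
  have hd : ∀ x : ℝ, HasDerivAt
      (fun x : ℝ => Complex.exp (-(Complex.I * u * x)) * (hermiteFun k x : ℂ))
      (((Real.sqrt 2)⁻¹ : ℝ) * ((Real.sqrt k : ℝ) *
          (Complex.exp (-(Complex.I * u * x)) * (hermiteFun (k - 1) x : ℂ)) -
        (Real.sqrt (k + 1) : ℝ) *
          (Complex.exp (-(Complex.I * u * x)) * (hermiteFun (k + 1) x : ℂ))) -
        Complex.I * u * (Complex.exp (-(Complex.I * u * x)) * (hermiteFun k x : ℂ))) x := by
    intro x
    have h1 : HasDerivAt (fun x : ℝ => Complex.exp (-(Complex.I * u * x)))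
        (Complex.exp (-(Complex.I * u * x)) * (-(Complex.I * u))) x := by
      have h0 : HasDerivAt (fun x : ℝ => -(Complex.I * u * (x : ℂ))) (-(Complex.I * u)) x := by
        simpa using ((hasDerivAt_id x).ofReal_comp.const_mul (Complex.I * (u : ℂ))).fun_neg
      exact h0.cexp
    refine (h1.fun_mul (hasDerivAt_hermiteFun k x).ofReal_comp).congr_deriv ?_
    push_cast
    ring
  have i (j : ℕ) := integrable_exp_mul (integrable_hermiteFun j) u
  have h := integral_eq_zero_of_hasDerivAt_of_integrable hd
    (((((i (k - 1)).const_mul _).sub ((i (k + 1)).const_mul _)).const_mul _).sub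
      ((i k).const_mul _)) (i k)
  rw [integral_linear_comb (i (k - 1)) (i (k + 1)) (i k)] at h
  exact (sub_eq_zero.1 h).symm

/-- Each factor u is traded, by the ladder relation, for a factor of order k + 1 and a shift of the
index by one. -/
theorem exists_abs_pow_mul_norm_hat_le (n : ℕ) : ∃ C : ℝ, 0 ≤ C ∧ ∃ c : ℕ, ∀ (k : ℕ) (u : ℝ),
    |u| ^ n * ‖hat (hermiteFun k) u‖ ≤ C * ((k : ℝ) + 1) ^ c := by
  induction n with
  | zero =>
    refine ⟨Real.pi + 2, by positivity, 1, fun k u => ?_⟩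
    simpa using (norm_hat_le u).trans (integral_abs_hermiteFun_le k)
  | succ n ih =>
    obtain ⟨C, hC, c, h⟩ := ih
    -- Each of the two neighbours is at most C (2(k+1))^c, and the ladder coefficients contribute
    -- one more factor k + 1.
    refine ⟨2 * C * 2 ^ c, by positivity, c + 1, fun k u => ?_⟩
    have hk : (0 : ℝ) ≤ k := Nat.cast_nonneg k
    have e := congrArg norm (mul_hat_hermiteFun k u)
    simp only [norm_mul, Complex.norm_I, one_mul, Complex.norm_real, Real.norm_eq_abs] at e
    have s1 : |(Real.sqrt 2)⁻¹| ≤ 1 := by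
      rw [abs_of_pos (by positivity)]
      exact inv_le_one_of_one_le₀ (Real.one_le_sqrt.2 (by norm_num))
    have s2 : Real.sqrt k ≤ k + 1 := Real.sqrt_le_iff.2 ⟨by positivity, by nlinarith⟩
    have s3 : Real.sqrt (k + 1) ≤ k + 1 := Real.sqrt_le_iff.2 ⟨by positivity, by nlinarith⟩
    have b1 : ‖hat (hermiteFun k) u‖ * |u| ≤
        (k + 1) * (‖hat (hermiteFun (k - 1)) u‖ + ‖hat (hermiteFun (k + 1)) u‖) := by
      rw [mul_comm, e]
      refine (mul_le_of_le_one_left (norm_nonneg _) s1).trans ((norm_sub_le _ _).trans ?_)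
      simp only [norm_mul, Complex.norm_real, Real.norm_eq_abs, abs_of_nonneg (Real.sqrt_nonneg _)]
      rw [mul_add]
      gcongr
    have b2 : |u| ^ n * ‖hat (hermiteFun (k - 1)) u‖ ≤ C * (2 * ((k : ℝ) + 1)) ^ c := by
      refine (h (k - 1) u).trans ?_
      have : ((k - 1 : ℕ) : ℝ) ≤ k := by exact_mod_cast Nat.sub_le k 1
      gcongr
      linarith
    have b3 : |u| ^ n * ‖hat (hermiteFun (k + 1)) u‖ ≤ C * (2 * ((k : ℝ) + 1)) ^ c := by
      refine (h (k + 1) u).trans ?_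
      gcongr
      push_cast
      linarith
    calc |u| ^ (n + 1) * ‖hat (hermiteFun k) u‖
        = |u| ^ n * (‖hat (hermiteFun k) u‖ * |u|) := by ring
      _ ≤ |u| ^ n * ((k + 1) *
          (‖hat (hermiteFun (k - 1)) u‖ + ‖hat (hermiteFun (k + 1)) u‖)) := by gcongr
      _ = (k + 1) * (|u| ^ n * ‖hat (hermiteFun (k - 1)) u‖ +
          |u| ^ n * ‖hat (hermiteFun (k + 1)) u‖) := by ring
      _ ≤ (k + 1) * (C * (2 * ((k : ℝ) + 1)) ^ c + C * (2 * ((k : ℝ) + 1)) ^ c) := by gcongr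
      _ = 2 * C * 2 ^ c * ((k : ℝ) + 1) ^ (c + 1) := by rw [mul_pow]; ring

/-! ### Integrable majorants for √m η̂_k and bounds on T_m η_k -/

theorem integrable_indicator_abs_rpow {r : ℝ} (hr : -1 < r) :
    Integrable ((Set.Icc (-1 : ℝ) 1).indicator fun u => |u| ^ r) := by
  have h := (intervalIntegral.intervalIntegrable_rpow' (a := 0) (b := 1) hr).1
  have h1 : Integrable ((Set.Ioc (0 : ℝ) 1).indicator fun u => u ^ r) :=
    h.integrable_indicator measurableSet_Ioc
  refine (h1.add h1.comp_neg).congr ?_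
  have h0 : ∀ᵐ u : ℝ, u ≠ 0 := by simp [ae_iff]
  filter_upwards [h0] with u hu
  simp only [Pi.add_apply]
  rcases lt_or_gt_of_ne hu with h | h
  · rw [Set.indicator_of_notMem (by simp [h.le]), zero_add]
    by_cases h2 : -1 ≤ u
    · rw [Set.indicator_of_mem (by simp; constructor <;> linarith),
        Set.indicator_of_mem (by simp; constructor <;> linarith), abs_of_neg h]
    · rw [Set.indicator_of_notMem (by simp; intros; linarith),
        Set.indicator_of_notMem (by simp; intros; linarith)]
  · rw [Set.indicator_of_notMem (a := -u) (by simp; intros; linarith), add_zero]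
    by_cases h2 : u ≤ 1
    · rw [Set.indicator_of_mem (by simp; constructor <;> linarith),
        Set.indicator_of_mem (by simp; constructor <;> linarith), abs_of_pos h]
    · rw [Set.indicator_of_notMem (by simp; intros; linarith),
        Set.indicator_of_notMem (by simp; intros; linarith)]

/-- The functions `√m η̂_k` have an integrable majorant that grows polynomially in `k`. -/
theorem exists_sqrt_mul_norm_hat_le {m : ℝ → ℝ} {K β : ℝ} {N : ℕ} (hK : 0 < K) (hβ : β < 2)
    (hm_small : ∀ u : ℝ, 0 < |u| → |u| ≤ 1 → m u ≤ K * |u| ^ (-β))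
    (hm_large : ∀ u : ℝ, 1 < |u| → m u ≤ K * |u| ^ (2 * N)) :
    ∃ g : ℝ → ℝ, Integrable g ∧ ∃ C : ℝ, 0 ≤ C ∧ ∃ c : ℕ, ∀ k : ℕ, ∀ᵐ u : ℝ,
      Real.sqrt (m u) * ‖hat (hermiteFun k) u‖ ≤ C * ((k : ℝ) + 1) ^ c * g u := by
  -- The plain bound serves for |u| ≤ 1. For |u| > 1, N powers compensate √m and two more give
  -- integrability at infinity.
  obtain ⟨C₀, hC₀, c₀, h₀⟩ := exists_abs_pow_mul_norm_hat_le 0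
  obtain ⟨C₁, hC₁, c₁, h₁⟩ := exists_abs_pow_mul_norm_hat_le (N + 2)
  -- The square root halves the singularity: β < 2 gives -β/2 > -1, so this is integrable at the
  -- origin.
  set g₀ : ℝ → ℝ := (Set.Icc (-1 : ℝ) 1).indicator fun u => |u| ^ (-β / 2) with hg₀
  have hg₀_nonneg : ∀ u, 0 ≤ g₀ u := fun u =>
    Set.indicator_nonneg (fun u _ => Real.rpow_nonneg (abs_nonneg u) _) u
  refine ⟨fun u => g₀ u + 2 * (1 + u ^ 2)⁻¹,
    (integrable_indicator_abs_rpow (by linarith)).add (integrable_inv_one_add_sq.const_mul 2),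
    Real.sqrt K * (C₀ + C₁), by positivity, c₀ + c₁, fun k => ?_⟩
  have hz : ∀ᵐ u : ℝ, u ≠ 0 := by simp [ae_iff]
  filter_upwards [hz] with u hu
  have hupos : 0 < |u| := abs_pos.2 hu
  have hk1 : (1 : ℝ) ≤ k + 1 := by simp
  have hp0 : ((k : ℝ) + 1) ^ c₀ ≤ ((k : ℝ) + 1) ^ (c₀ + c₁) :=
    pow_le_pow_right₀ hk1 (by omega)
  have hp1 : ((k : ℝ) + 1) ^ c₁ ≤ ((k : ℝ) + 1) ^ (c₀ + c₁) :=
    pow_le_pow_right₀ hk1 (by omega)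
  have hi : 0 < 1 + u ^ 2 := by positivity
  rcases le_or_gt |u| 1 with h | h
  · have hmem : u ∈ Set.Icc (-1 : ℝ) 1 := abs_le.1 h
    have e : Real.sqrt (m u) ≤ Real.sqrt K * g₀ u := by
      rw [hg₀, Set.indicator_of_mem hmem]
      refine (Real.sqrt_le_sqrt (hm_small u hupos h)).trans_eq ?_
      rw [Real.sqrt_mul hK.le, Real.sqrt_eq_rpow (|u| ^ (-β)), ← Real.rpow_mul hupos.le]
      congr 2
      ring
    have hh := h₀ k u
    rw [pow_zero, one_mul] at hh
    calc Real.sqrt (m u) * ‖hat (hermiteFun k) u‖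
        ≤ (Real.sqrt K * g₀ u) * (C₀ * ((k : ℝ) + 1) ^ c₀) := by
          have := hg₀_nonneg u
          gcongr
      _ ≤ (Real.sqrt K * (g₀ u + 2 * (1 + u ^ 2)⁻¹)) *
          ((C₀ + C₁) * ((k : ℝ) + 1) ^ (c₀ + c₁)) := by
          have := hg₀_nonneg u
          gcongr
          · have : 0 ≤ 2 * (1 + u ^ 2)⁻¹ := by positivity
            linarith
          · linarith
      _ = _ := by ring
  · have e : Real.sqrt (m u) ≤ Real.sqrt K * |u| ^ N := by
      refine (Real.sqrt_le_sqrt (hm_large u h)).trans_eq ?_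
      rw [Real.sqrt_mul hK.le, mul_comm 2 N, pow_mul, Real.sqrt_sq (by positivity)]
    have hu2 : 1 ≤ 2 * (1 + u ^ 2)⁻¹ * |u| ^ 2 := by
      rw [sq_abs, mul_assoc, inv_mul_eq_div, mul_div_assoc', le_div_iff₀ hi]
      have : 1 < |u| ^ 2 := one_lt_pow₀ h (by norm_num)
      rw [sq_abs] at this
      linarith
    calc Real.sqrt (m u) * ‖hat (hermiteFun k) u‖
        ≤ (Real.sqrt K * |u| ^ N) * ‖hat (hermiteFun k) u‖ * 1 := by
          rw [mul_one]
          gcongr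
      _ ≤ (Real.sqrt K * |u| ^ N) * ‖hat (hermiteFun k) u‖ * (2 * (1 + u ^ 2)⁻¹ * |u| ^ 2) := by
          gcongr
      _ = Real.sqrt K * (2 * (1 + u ^ 2)⁻¹) * (|u| ^ (N + 2) * ‖hat (hermiteFun k) u‖) := by ring
      _ ≤ Real.sqrt K * (2 * (1 + u ^ 2)⁻¹) * (C₁ * ((k : ℝ) + 1) ^ c₁) := by
          exact mul_le_mul_of_nonneg_left (h₁ k u) (by positivity)
      _ ≤ Real.sqrt K * (g₀ u + 2 * (1 + u ^ 2)⁻¹) *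
          ((C₀ + C₁) * ((k : ℝ) + 1) ^ (c₀ + c₁)) := by
          have := hg₀_nonneg u
          gcongr
          · linarith
          · linarith
      _ = _ := by ring

/-- The function `√m η̂_k`. -/
def symbolHermite (m : ℝ → ℝ) (k : ℕ) (u : ℝ) : ℂ := (Real.sqrt (m u) : ℂ) * hat (hermiteFun k) u

theorem measurable_symbolHermite {m : ℝ → ℝ} (hm : Measurable m) (k : ℕ) :
    Measurable (symbolHermite m k) :=
  (Complex.measurable_ofReal.comp hm.sqrt).mul
    (continuous_hat (integrable_hermiteFun k)).measurable

theorem norm_symbolHermite (m : ℝ → ℝ) (k : ℕ) (u : ℝ) :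
    ‖symbolHermite m k u‖ = Real.sqrt (m u) * ‖hat (hermiteFun k) u‖ := by
  rw [symbolHermite, norm_mul, Complex.norm_real, Real.norm_of_nonneg (Real.sqrt_nonneg _)]

theorem opTValue_eq (m : ℝ → ℝ) (k : ℕ) (t : ℝ) : opTValue m (hermiteSchwartz k) t =
    ((2 * Real.pi : ℂ)⁻¹ * ∫ u : ℝ, Complex.exp (Complex.I * u * t) * symbolHermite m k u).re := by
  simp only [opTValue, symbolHermite, ← mul_assoc]
  rfl

theorem continuous_integral_exp_mul {f : ℝ → ℂ} (h : Integrable f) :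
    Continuous fun t : ℝ => ∫ u : ℝ, Complex.exp (Complex.I * u * t) * f u := by
  refine continuous_of_dominated (bound := fun u => ‖f u‖)
    (fun t => ?_) (fun t => ae_of_all _ fun u => ?_) h.norm (ae_of_all _ fun x => by fun_prop)
  · exact (Continuous.aestronglyMeasurable (by fun_prop)).mul h.aestronglyMeasurable
  · rw [norm_mul, norm_exp_I_mul_mul, one_mul]

theorem continuous_opTValue {m : ℝ → ℝ} (k : ℕ) (h : Integrable (symbolHermite m k)) :
    Continuous (opTValue m (hermiteSchwartz k)) := by
  have hc := continuous_integral_exp_mul h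
  simp only [funext (opTValue_eq m k)]
  fun_prop

/-- The functions `√m η̂_k` are integrable, and `T_m η_k` is bounded polynomially in `k`. -/
theorem exists_abs_opTValue_le {m : ℝ → ℝ} (hm : Measurable m) {K β : ℝ} {N : ℕ} (hK : 0 < K)
    (hβ : β < 2) (hm_small : ∀ u : ℝ, 0 < |u| → |u| ≤ 1 → m u ≤ K * |u| ^ (-β))
    (hm_large : ∀ u : ℝ, 1 < |u| → m u ≤ K * |u| ^ (2 * N)) :
    (∀ k, Integrable (symbolHermite m k)) ∧ ∃ C : ℝ, 0 ≤ C ∧ ∃ c : ℕ, ∀ k t,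
      |opTValue m (hermiteSchwartz k) t| ≤ C * ((k : ℝ) + 1) ^ c := by
  obtain ⟨g, hg, C, hC, c, h⟩ := exists_sqrt_mul_norm_hat_le hK hβ hm_small hm_large
  have hle : ∀ k : ℕ, ∀ᵐ u, ‖symbolHermite m k u‖ ≤ C * ((k : ℝ) + 1) ^ c * g u := fun k => by
    simpa only [norm_symbolHermite] using h k
  refine ⟨fun k => (hg.const_mul _).mono' (measurable_symbolHermite hm k).aestronglyMeasurable
    (hle k), C * |∫ u, g u|, by positivity, c, fun k t => ?_⟩
  rw [opTValue_eq]
  refine (Complex.abs_re_le_norm _).trans ?_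
  have h1 : ‖(2 * Real.pi : ℂ)⁻¹‖ ≤ 1 := by
    rw [norm_inv, norm_mul, Complex.norm_real, Real.norm_of_nonneg Real.pi_pos.le,
      Complex.norm_ofNat]
    exact inv_le_one_of_one_le₀ (by linarith [Real.pi_gt_three])
  rw [norm_mul]
  refine (mul_le_of_le_one_left (norm_nonneg _) h1).trans ?_
  refine (norm_integral_le_of_norm_le (hg.const_mul (C * ((k : ℝ) + 1) ^ c)) ?_).trans ?_
  · filter_upwards [hle k] with u hu
    rwa [norm_mul, norm_exp_I_mul_mul, one_mul]
  · rw [integral_const_mul]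
    have := mul_le_mul_of_nonneg_left (le_abs_self (∫ u, g u))
      (show 0 ≤ C * ((k : ℝ) + 1) ^ c by positivity)
    linarith

/-! ### White noise -/

/-- The `L²` inner product of two real Schwartz functions. -/
def l2inner (s r : 𝓢(ℝ, ℝ)) : ℝ := ∫ x, s x * r x

theorem integrable_schwartz_mul (s r : 𝓢(ℝ, ℝ)) : Integrable fun x => s x * r x :=
  (s.memLp 2).integrable_mul (r.memLp 2)

theorem l2inner_comm (s r : 𝓢(ℝ, ℝ)) : l2inner s r = l2inner r s := by
  simp only [l2inner, mul_comm]

theorem l2inner_add_left (s s' r : 𝓢(ℝ, ℝ)) :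
    l2inner (s + s') r = l2inner s r + l2inner s' r := by
  simp only [l2inner, add_apply, add_mul]
  exact integral_add (integrable_schwartz_mul s r) (integrable_schwartz_mul s' r)

theorem l2inner_smul_left (c : ℝ) (s r : 𝓢(ℝ, ℝ)) : l2inner (c • s) r = c * l2inner s r := by
  simp only [l2inner, smul_apply, smul_eq_mul, mul_assoc]
  exact integral_const_mul _ _

theorem l2inner_sub_left (s s' r : 𝓢(ℝ, ℝ)) :
    l2inner (s - s') r = l2inner s r - l2inner s' r := by
  rw [sub_eq_add_neg, ← neg_one_smul ℝ s', l2inner_add_left, l2inner_smul_left]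
  ring

theorem l2inner_sum_left {ι : Type*} (S : Finset ι) (e : ι → 𝓢(ℝ, ℝ)) (r : 𝓢(ℝ, ℝ)) :
    l2inner (∑ i ∈ S, e i) r = ∑ i ∈ S, l2inner (e i) r := by
  classical
  induction S using Finset.induction_on with
  | empty => simp [l2inner]
  | insert i S hi ih => rw [Finset.sum_insert hi, Finset.sum_insert hi, l2inner_add_left, ih]

theorem l2inner_hermiteSchwartz (j k : ℕ) :
    l2inner (hermiteSchwartz j) (hermiteSchwartz k) = if j = k then 1 else 0 :=
  integral_hermiteFun_mul j k

theorem measurable_eval_omega (s : 𝓢(ℝ, ℝ)) : Measurable fun ω : Omega => ω s :=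
  (continuous_eval_const s).measurable

variable {P : Measure Omega}

theorem IsWhiteNoise.charFun_eq (hP : IsWhiteNoise P) (s : 𝓢(ℝ, ℝ)) :
    ∫ ω : Omega, Complex.exp (((ω s : ℝ) : ℂ) * Complex.I) ∂P =
      Complex.exp (-(l2inner s s : ℂ) / 2) := by
  have h := hP.2 s
  simp only [pow_two] at h
  rw [l2inner, ← h]
  simp only [mul_comm]

/-- The characteristic functional at t s, as a function of real t, is the characteristic function of
N(0, ‖s‖²). -/
theorem IsWhiteNoise.map_eq (hP : IsWhiteNoise P) (s : 𝓢(ℝ, ℝ)) :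
    P.map (fun ω => ω s) = gaussianReal 0 (l2inner s s).toNNReal := by
  have := hP.1
  have hpos : 0 ≤ l2inner s s := integral_nonneg fun x => mul_self_nonneg _
  have : IsProbabilityMeasure (P.map (fun ω : Omega => ω s)) :=
    Measure.isProbabilityMeasure_map (measurable_eval_omega s).aemeasurable
  refine Measure.ext_of_charFun (funext fun t => ?_)
  rw [charFun_gaussianReal, charFun_apply_real,
    integral_map (measurable_eval_omega s).aemeasurable
      (Continuous.aestronglyMeasurable (by fun_prop))]
  have h := hP.charFun_eq (t • s)
  simp only [map_smul, smul_eq_mul, Complex.ofReal_mul] at h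
  rw [h, l2inner_smul_left, l2inner_comm, l2inner_smul_left, Real.coe_toNNReal _ hpos]
  congr 1
  push_cast
  ring

/-- The joint characteristic function is exp(-‖∑ t_i e_i‖²/2), which factorizes because
orthogonality removes the cross terms. -/
theorem IsWhiteNoise.iIndepFun_of_orthogonal (hP : IsWhiteNoise P) {ι : Type*} [Fintype ι]
    (e : ι → 𝓢(ℝ, ℝ)) (he : ∀ i j, i ≠ j → l2inner (e i) (e j) = 0) :
    iIndepFun (fun i (ω : Omega) => ω (e i)) P := by
  classical
  have := hP.1
  have hm : ∀ i, Measurable fun ω : Omega => ω (e i) := fun i => measurable_eval_omega (e i)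
  have hm2 : Measurable fun ω : Omega => WithLp.toLp 2 fun i => ω (e i) :=
    (WithLp.measurable_toLp 2 _).comp (measurable_pi_lambda _ hm)
  rw [iIndepFun_iff_charFun_pi fun i => (hm i).aemeasurable]
  intro t
  have hsum : l2inner (∑ i, t i • e i) (∑ i, t i • e i) = ∑ i, t i ^ 2 * l2inner (e i) (e i) := by
    rw [l2inner_sum_left]
    refine Finset.sum_congr rfl fun i _ => ?_
    rw [l2inner_smul_left, l2inner_comm, l2inner_sum_left, Finset.sum_eq_single i]
    · rw [l2inner_smul_left]
      ring
    · intro j _ hj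
      rw [l2inner_smul_left, he j i hj, mul_zero]
    · simp
  have h := hP.charFun_eq (∑ i, t i • e i)
  rw [charFun_apply, integral_map hm2.aemeasurable (Continuous.aestronglyMeasurable (by fun_prop))]
  have h1 : ∀ ω : Omega, Complex.exp (((inner ℝ (WithLp.toLp 2 fun i => ω (e i)) t : ℝ) : ℂ) *
      Complex.I) = Complex.exp (((ω (∑ i, t i • e i) : ℝ) : ℂ) * Complex.I) := by
    intro ω
    congr 3
    rw [PiLp.inner_apply, map_sum]
    exact Finset.sum_congr rfl fun i _ => by simp
  simp only [h1]
  rw [h, hsum, Complex.ofReal_sum, ← Finset.sum_neg_distrib, Finset.sum_div, Complex.exp_sum]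
  refine Finset.prod_congr rfl fun i _ => ?_
  have hi := hP.charFun_eq (t i • e i)
  rw [l2inner_smul_left, l2inner_comm, l2inner_smul_left] at hi
  rw [charFun_apply_real, integral_map (hm i).aemeasurable
    (Continuous.aestronglyMeasurable (by fun_prop))]
  simp only [map_smul, smul_eq_mul, Complex.ofReal_mul] at hi
  rw [hi]
  congr 1
  push_cast
  ring

theorem IsWhiteNoise.integral_eval_polynomial (hP : IsWhiteNoise P) {s : 𝓢(ℝ, ℝ)}
    (hs : l2inner s s = 1) (q : ℝ[X]) : ∫ ω, q.eval (ω s) ∂P = gaussE q := by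
  rw [gaussE, ← Real.toNNReal_one, ← hs, ← hP.map_eq s,
    integral_map (measurable_eval_omega s).aemeasurable q.continuous.aestronglyMeasurable]

theorem IsWhiteNoise.memLp_eval (hP : IsWhiteNoise P) (s : 𝓢(ℝ, ℝ)) :
    MemLp (fun ω : Omega => ω s) 2 P := by
  have h := memLp_eval_gaussianReal (l2inner s s).toNNReal Polynomial.X
  rw [← hP.map_eq s, memLp_map_measure_iff Polynomial.X.continuous.aestronglyMeasurable
    (measurable_eval_omega s).aemeasurable] at h
  simpa [Function.comp_def] using h

theorem IsWhiteNoise.integral_eval (hP : IsWhiteNoise P) (s : 𝓢(ℝ, ℝ)) :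
    ∫ ω : Omega, ω s ∂P = 0 := by
  have h : ∫ x, x ∂(P.map fun ω : Omega => ω s) = 0 := by
    rw [hP.map_eq, integral_id_gaussianReal]
  rwa [integral_map (f := fun x : ℝ => x) (measurable_eval_omega s).aemeasurable
    continuous_id.aestronglyMeasurable] at h

theorem IsWhiteNoise.integral_eval_sq (hP : IsWhiteNoise P) (s : 𝓢(ℝ, ℝ)) :
    ∫ ω : Omega, (ω s) ^ 2 ∂P = l2inner s s := by
  have hpos : 0 ≤ l2inner s s := integral_nonneg fun x => mul_self_nonneg _
  have h : ∫ x, x ^ 2 ∂(P.map fun ω : Omega => ω s) = l2inner s s := by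
    have hv := variance_fun_id_gaussianReal (μ := 0) (v := (l2inner s s).toNNReal)
    rw [variance_of_integral_eq_zero measurable_id'.aemeasurable
      integral_id_gaussianReal, Real.coe_toNNReal _ hpos] at hv
    rw [hP.map_eq]
    exact hv
  rwa [integral_map (measurable_eval_omega s).aemeasurable
    (Continuous.aestronglyMeasurable (by fun_prop))] at h

/-! ### Expectations of ⟨ω, s⟩ H_α -/

theorem basisH_eq (α : Multiindex) (ω : Omega) :
    basisH α ω = ∏ i : α.support, (hermiteReal (α i)).eval (ω (hermiteSchwartz i)) := by
  rw [basisH, Finsupp.prod, ← Finset.prod_coe_sort]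
  simp only [aeval_hermite]

theorem measurable_basisH (α : Multiindex) : Measurable (basisH α) := by
  rw [funext (basisH_eq α)]
  exact Finset.measurable_fun_prod _ fun i _ =>
    (hermiteReal (α i)).continuous.measurable.comp (measurable_eval_omega _)

theorem iIndepFun_hermite (hP : IsWhiteNoise P) (S : Finset ℕ) :
    iIndepFun (fun (i : S) (ω : Omega) => ω (hermiteSchwartz i)) P :=
  hP.iIndepFun_of_orthogonal (fun i : S => hermiteSchwartz i) fun i j hij => by
    rw [l2inner_hermiteSchwartz, if_neg fun h => hij (Subtype.ext h)]

/-- By independence the joint law of the coordinates is a product, so the claim reduces to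
polynomials in one Gaussian variable. -/
theorem IsWhiteNoise.memLp_basisH (hP : IsWhiteNoise P) (α : Multiindex) :
    MemLp (basisH α) 2 P := by
  have := hP.1
  rw [memLp_two_iff_integrable_sq (measurable_basisH α).aestronglyMeasurable]
  have hI := iIndepFun_hermite hP α.support
  have hX : ∀ i : α.support, AEMeasurable (fun ω : Omega => ω (hermiteSchwartz i)) P :=
    fun i => (measurable_eval_omega _).aemeasurable
  have h1 : Integrable (fun x : α.support → ℝ =>
      ∏ i : α.support, ((hermiteReal (α i)).eval (x i)) ^ 2) (P.map fun ω i => ω (hermiteSchwartz i)) := by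
    rw [hI.map_fun_eq_pi_map hX]
    refine Integrable.fintype_prod (f := fun (i : α.support) (x : ℝ) =>
      ((hermiteReal (α i)).eval x) ^ 2) fun i => ?_
    rw [hP.map_eq]
    exact (memLp_eval_gaussianReal _ _).integrable_sq
  have h2 := h1.comp_aemeasurable (aemeasurable_pi_lambda _ hX)
  refine h2.congr (ae_of_all _ fun ω => ?_)
  simp only [Function.comp, basisH_eq, Finset.prod_pow]

/-- Independence factorizes the expectation. The factor at k is nonzero only if α_k = 1, and any
other index of the support contributes E[h_{α_i}] = 0. -/
theorem IsWhiteNoise.integral_hermite_mul_basisH (hP : IsWhiteNoise P) (α : Multiindex) (k : ℕ)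
    (hk : k ∈ α.support) : ∫ ω : Omega, ω (hermiteSchwartz k) * basisH α ω ∂P =
      if α = Finsupp.single k 1 then 1 else 0 := by
  classical
  set f : α.support → ℝ[X] := fun i =>
    if (i : ℕ) = k then Polynomial.X * hermiteReal (α i) else hermiteReal (α i) with hf
  have h1 : ∀ ω : Omega, ω (hermiteSchwartz k) * basisH α ω =
      ∏ i : α.support, (f i).eval (ω (hermiteSchwartz i)) := by
    intro ω
    rw [basisH_eq, ← Finset.mul_prod_erase _ _ (Finset.mem_univ ⟨k, hk⟩),
      ← Finset.mul_prod_erase _ _ (Finset.mem_univ ⟨k, hk⟩), ← mul_assoc]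
    congr 1
    · simp [hf]
    · refine Finset.prod_congr rfl fun i hi => ?_
      have : (i : ℕ) ≠ k := fun h => (Finset.ne_of_mem_erase hi) (Subtype.ext h)
      simp [hf, this]
  simp only [h1]
  rw [(iIndepFun_hermite hP α.support).integral_fun_prod_comp (f := fun i x => (f i).eval x)
    (fun i => (measurable_eval_omega _).aemeasurable)
    (fun i => (f i).continuous.aestronglyMeasurable)]
  have h2 : ∀ i : α.support, ∫ ω : Omega, (f i).eval (ω (hermiteSchwartz i)) ∂P = gaussE (f i) :=
    fun i => hP.integral_eval_polynomial (by simp [l2inner_hermiteSchwartz]) _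
  simp only [h2]
  split_ifs with h
  · refine Finset.prod_eq_one fun i _ => ?_
    have hi : (i : ℕ) = k := by
      have h3 : (i : ℕ) ∈ (Finsupp.single k 1).support := h ▸ i.2
      simpa using Finsupp.support_single_subset h3
    simp [hf, hi, gaussE_X_mul_hermiteReal, h]
  · by_contra hne
    refine h ?_
    have hall : ∀ i : α.support, gaussE (f i) ≠ 0 := fun i hi =>
      hne (Finset.prod_eq_zero (Finset.mem_univ i) hi)
    ext j
    by_cases hj : j ∈ α.support
    · have := hall ⟨j, hj⟩
      by_cases hjk : j = k
      · subst hjk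
        simp only [hf, if_true, gaussE_X_mul_hermiteReal] at this
        simpa using this
      · simp only [hf, hjk, if_false, gaussE_hermiteReal] at this
        exact absurd (by simpa using this) (Finsupp.mem_support_iff.1 hj)
    · have hjk : k ≠ j := fun e => hj (e ▸ hk)
      rw [Finsupp.notMem_support_iff.1 hj, Finsupp.single_eq_of_ne hjk.symm]

/-- Here ⟨ω, r⟩ is centred and independent of the coordinates in H_α; r is adjoined to the family as
the index `none`. -/
theorem IsWhiteNoise.integral_orthogonal_mul_basisH (hP : IsWhiteNoise P) (α : Multiindex)
    (r : 𝓢(ℝ, ℝ)) (hr : ∀ k ∈ α.support, l2inner r (hermiteSchwartz k) = 0) :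
    ∫ ω : Omega, ω r * basisH α ω ∂P = 0 := by
  set e : Option α.support → 𝓢(ℝ, ℝ) := fun o => o.elim r fun i => hermiteSchwartz i with he
  have hI := hP.iIndepFun_of_orthogonal e (by
    rintro (_ | i) (_ | j) hij
    · exact absurd rfl hij
    · exact hr j j.2
    · rw [l2inner_comm]; exact hr i i.2
    · have : (i : ℕ) ≠ j := fun h => hij (congrArg some (Subtype.ext h))
      simp only [he, Option.elim, l2inner_hermiteSchwartz, this, if_false])
  set f : Option α.support → ℝ[X] := fun o => o.elim Polynomial.X fun i => hermiteReal (α i)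
    with hf
  have h := hI.integral_fun_prod_comp (f := fun o x => (f o).eval x)
    (fun i => (measurable_eval_omega _).aemeasurable)
    (fun i => (f i).continuous.aestronglyMeasurable)
  simp only [Fintype.prod_option, hf, he, Option.elim, eval_X, hP.integral_eval, zero_mul] at h
  simpa only [basisH_eq] using h

/-- Only the finitely many η_k with k in the support of α matter: s is their projection plus a
remainder orthogonal to them, and both stay in the Schwartz space. -/
theorem IsWhiteNoise.integral_eval_mul_basisH (hP : IsWhiteNoise P) (α : Multiindex)
    (s : 𝓢(ℝ, ℝ)) : ∫ ω : Omega, ω s * basisH α ω ∂P =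
      ∑ k ∈ α.support, if α = Finsupp.single k 1 then l2inner s (hermiteSchwartz k) else 0 := by
  set p : 𝓢(ℝ, ℝ) := ∑ k ∈ α.support, l2inner s (hermiteSchwartz k) • hermiteSchwartz k with hp
  have hr : ∀ k ∈ α.support, l2inner (s - p) (hermiteSchwartz k) = 0 := by
    intro k hk
    rw [l2inner_sub_left, hp, l2inner_sum_left, Finset.sum_eq_single k]
    · simp [l2inner_smul_left, l2inner_hermiteSchwartz]
    · intro j _ hj
      simp [l2inner_smul_left, l2inner_hermiteSchwartz, hj]
    · exact fun h => absurd hk h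
  have hint : ∀ r : 𝓢(ℝ, ℝ), Integrable (fun ω : Omega => ω r * basisH α ω) P :=
    fun r => (hP.memLp_eval r).integrable_mul (hP.memLp_basisH α)
  have hsp : ∀ ω : Omega, ω s * basisH α ω = ω (s - p) * basisH α ω +
      ∑ k ∈ α.support, l2inner s (hermiteSchwartz k) * (ω (hermiteSchwartz k) * basisH α ω) := by
    intro ω
    rw [map_sub, hp, map_sum, sub_mul, Finset.sum_mul]
    simp only [map_smul, smul_eq_mul, mul_assoc, sub_add_cancel]
  simp only [hsp]
  rw [integral_add (hint _) (integrable_finsetSum _ fun k _ => (hint _).const_mul _),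
    hP.integral_orthogonal_mul_basisH α _ hr, zero_add,
    integral_finsetSum _ fun k _ => (hint _).const_mul _]
  refine Finset.sum_congr rfl fun k hk => ?_
  rw [integral_const_mul, hP.integral_hermite_mul_basisH α k hk]
  simp

/-! ### The extension `Q` and chaos coefficients -/

theorem IsWhiteNoise.evalL2_eq (hP : IsWhiteNoise P) (s : 𝓢(ℝ, ℝ)) :
    evalL2 P s = (hP.memLp_eval s).toLp _ := by
  rw [evalL2, dif_pos (hP.memLp_eval s)]

theorem inner_toLp_eq {Ω : Type*} [MeasurableSpace Ω] {μ : Measure Ω} {f : Ω → ℝ}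
    (hf : MemLp f 2 μ) (F : Lp ℝ 2 μ) : inner ℝ (hf.toLp f) F = ∫ ω, F ω * f ω ∂μ := by
  rw [L2.inner_def]
  refine integral_congr_ae ?_
  filter_upwards [hf.coeFn_toLp] with ω hω
  simp [hω]

theorem inner_schwartz_toLp (r : 𝓢(ℝ, ℝ)) (f : Lp ℝ 2 (volume : Measure ℝ)) :
    inner ℝ (r.toLp 2 volume) f = ∫ x, f x * r x :=
  inner_toLp_eq (r.memLp 2) f

theorem inner_schwartz_schwartz (r s : 𝓢(ℝ, ℝ)) :
    inner ℝ (r.toLp 2 volume) (s.toLp 2 volume) = l2inner s r := by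
  rw [inner_schwartz_toLp, l2inner]
  refine integral_congr_ae ?_
  filter_upwards [s.coeFn_toLp 2 volume] with x hx
  rw [hx]

theorem IsWhiteNoise.dist_evalL2 (hP : IsWhiteNoise P) (s r : 𝓢(ℝ, ℝ)) :
    dist (evalL2 P s) (evalL2 P r) = dist (s.toLp 2 volume) (r.toLp 2 volume) := by
  have h1 : evalL2 P s - evalL2 P r = (hP.memLp_eval (s - r)).toLp _ := by
    rw [hP.evalL2_eq, hP.evalL2_eq, ← MemLp.toLp_sub]
    congr 1
    funext ω
    simp
  have h2 : s.toLp 2 (volume : Measure ℝ) - r.toLp 2 volume = (s - r).toLp 2 volume :=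
    (map_sub (SchwartzMap.toLpCLM ℝ ℝ 2 (volume : Measure ℝ)) s r).symm
  rw [dist_eq_norm, dist_eq_norm, h1, h2, ← sq_eq_sq₀ (norm_nonneg _) (norm_nonneg _),
    ← real_inner_self_eq_norm_sq, ← real_inner_self_eq_norm_sq, inner_schwartz_schwartz,
    inner_toLp_eq, ← hP.integral_eval_sq]
  refine integral_congr_ae ?_
  filter_upwards [(hP.memLp_eval (s - r)).coeFn_toLp] with ω hω
  rw [hω, pow_two]

theorem neBot_comap_toLp (f : Lp ℝ 2 (volume : Measure ℝ)) :
    (comap (fun s : 𝓢(ℝ, ℝ) => s.toLp 2 volume) (𝓝 f)).NeBot := by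
  have h : DenseRange (fun s : 𝓢(ℝ, ℝ) => s.toLp 2 (volume : Measure ℝ)) :=
    SchwartzMap.denseRange_toLpCLM (E := ℝ) (F := ℝ) (p := 2) (μ := volume) (by simp)
  exact comap_neBot fun _ ht => h.mem_nhds ht

/-- The limit defining `Q` exists: s ↦ ⟨ω, s⟩ is isometric, so the image filter is Cauchy, and L²(P)
is complete. -/
theorem IsWhiteNoise.tendsto_evalL2 (hP : IsWhiteNoise P) (f : Lp ℝ 2 (volume : Measure ℝ)) :
    Tendsto (evalL2 P) (comap (fun s : 𝓢(ℝ, ℝ) => s.toLp 2 volume) (𝓝 f)) (𝓝 (Q P f)) := by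
  have := neBot_comap_toLp f
  refine tendsto_nhds_limUnder ?_
  have hc : Cauchy (map (evalL2 P) (comap (fun s : 𝓢(ℝ, ℝ) => s.toLp 2 volume) (𝓝 f))) := by
    refine Metric.cauchy_iff.2 ⟨this.map _, fun ε hε => ?_⟩
    refine ⟨_, image_mem_map (preimage_mem_comap (Metric.ball_mem_nhds f (half_pos hε))), ?_⟩
    rintro _ ⟨s, hs, rfl⟩ _ ⟨r, hr, rfl⟩
    rw [hP.dist_evalL2]
    simp only [Set.mem_preimage, Metric.mem_ball] at hs hr
    have := dist_triangle_right (s.toLp 2 volume) (r.toLp 2 volume) f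
    linarith
  exact CompleteSpace.complete hc

theorem IsWhiteNoise.chaosCoeff_eq_inner (hP : IsWhiteNoise P) (F : Lp ℝ 2 P) (α : Multiindex) :
    chaosCoeff P F α = (mfactorial α)⁻¹ * inner ℝ ((hP.memLp_basisH α).toLp _) F := by
  rw [chaosCoeff, inner_toLp_eq]

theorem IsWhiteNoise.chaosCoeff_sub (hP : IsWhiteNoise P) (F G : Lp ℝ 2 P) (α : Multiindex) :
    chaosCoeff P (F - G) α = chaosCoeff P F α - chaosCoeff P G α := by
  simp only [hP.chaosCoeff_eq_inner, inner_sub_right, mul_sub]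

/-- The first order chaos element with coefficients `c`. -/
def firstChaos (c : ℕ → ℝ) (α : Multiindex) : ℝ :=
  ∑ k ∈ α.support, if α = Finsupp.single k 1 then c k else 0

theorem firstChaos_single (c : ℕ → ℝ) (k : ℕ) : firstChaos c (Finsupp.single k 1) = c k := by
  rw [firstChaos, Finsupp.support_single k one_ne_zero]
  simp

theorem firstChaos_of_ne (c : ℕ → ℝ) {α : Multiindex} (h : ∀ k, α ≠ Finsupp.single k 1) :
    firstChaos c α = 0 :=
  Finset.sum_eq_zero fun k _ => if_neg (h k)

theorem IsWhiteNoise.chaosCoeff_evalL2 (hP : IsWhiteNoise P) (s : 𝓢(ℝ, ℝ)) (α : Multiindex) :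
    chaosCoeff P (evalL2 P s) α = firstChaos (fun k => l2inner s (hermiteSchwartz k)) α := by
  have h : ∫ ω, evalL2 P s ω * basisH α ω ∂P = ∫ ω : Omega, ω s * basisH α ω ∂P := by
    rw [hP.evalL2_eq]
    refine integral_congr_ae ?_
    filter_upwards [(hP.memLp_eval s).coeFn_toLp] with ω hω
    rw [hω]
  rw [chaosCoeff, h, hP.integral_eval_mul_basisH]
  change _ * firstChaos (fun k => l2inner s (hermiteSchwartz k)) α = _
  by_cases hα : ∃ k, α = Finsupp.single k 1
  · obtain ⟨k, rfl⟩ := hα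
    simp [mfactorial]
  · rw [firstChaos_of_ne _ (not_exists.1 hα), mul_zero]

/-- Both sides are built from inner products, hence continuous in the L² norm, and they agree on the
dense set of Schwartz functions. -/
theorem IsWhiteNoise.chaosCoeff_Q (hP : IsWhiteNoise P) (f : Lp ℝ 2 (volume : Measure ℝ))
    (α : Multiindex) : chaosCoeff P (Q P f) α =
      firstChaos (fun k => ∫ x, f x * hermiteFun k x) α := by
  have := neBot_comap_toLp f
  set L := comap (fun s : 𝓢(ℝ, ℝ) => s.toLp 2 (volume : Measure ℝ)) (𝓝 f)
  have h1 : Tendsto (fun s => chaosCoeff P (evalL2 P s) α) L (𝓝 (chaosCoeff P (Q P f) α)) := by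
    simp only [hP.chaosCoeff_eq_inner]
    exact (tendsto_const_nhds.inner (hP.tendsto_evalL2 f)).const_mul _
  have h2 : Tendsto (fun s => chaosCoeff P (evalL2 P s) α) L
      (𝓝 (firstChaos (fun k => ∫ x, f x * hermiteFun k x) α)) := by
    simp only [hP.chaosCoeff_evalL2, firstChaos]
    refine tendsto_finsetSum _ fun k _ => ?_
    split_ifs
    · have h3 : ∫ x, f x * hermiteFun k x = inner ℝ ((hermiteSchwartz k).toLp 2 volume) f :=
        (inner_schwartz_toLp (hermiteSchwartz k) f).symm
      simp only [h3, ← inner_schwartz_schwartz]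
      exact tendsto_const_nhds.inner tendsto_comap
    · exact tendsto_const_nhds
  exact tendsto_nhds_unique h1 h2

/-! ### The operator `T_m` on indicator functions -/

/-- The Fourier transforms on `L²` and on `L¹` agree on `L¹ ∩ L²`. -/
theorem fourier_L2_ae_eq (f : Lp ℂ 2 (volume : Measure ℝ)) (hf : Integrable f) :
    (𝓕 f : Lp ℂ 2 (volume : Measure ℝ)) =ᵐ[volume] 𝓕 (f : ℝ → ℂ) := by
  have hcont : Continuous (𝓕 (f : ℝ → ℂ)) :=
    VectorFourier.fourierIntegral_continuous Real.continuous_fourierChar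
      (by exact continuous_inner) hf
  -- Both transforms are tested against smooth compactly supported g. The L² transform is the
  -- distributional one, and for f integrable Fubini moves 𝓕 from the test function to f.
  refine ae_eq_of_integral_contDiff_smul_eq ((Lp.memLp _).locallyIntegrable (by norm_num))
    hcont.locallyIntegrable fun g hg hgc => ?_
  set G : 𝓢(ℝ, ℂ) := (hgc.toSchwartzMap hg).postcompCLM Complex.ofRealCLM with hG
  have hGx : ∀ x, G x = (g x : ℂ) := fun x => rfl
  have h := congrArg (fun T : TemperedDistribution ℝ ℂ => T G) (Lp.fourier_toTemperedDistribution_eq f)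
  simp only [TemperedDistribution.fourier_apply, Lp.toTemperedDistribution_apply] at h
  have h2 : ∫ x, (𝓕 G) x • f x = ∫ x, G x • 𝓕 (f : ℝ → ℂ) x := by
    have h3 := VectorFourier.integral_fourierIntegral_smul_eq_flip (L := innerₗ ℝ)
      (μ := (volume : Measure ℝ)) (ν := (volume : Measure ℝ))
      Real.continuous_fourierChar (by exact continuous_inner) (G.integrable) hf
    rw [flip_innerₗ] at h3
    exact h3
  rw [h2] at h
  simp only [hGx, Complex.coe_smul] at h
  exact h.symm

/-- Half-open intervals match the definition of the interval integral for either sign of t. -/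
theorem indicatorL2_ae_eq (t : ℝ) : ∀ᵐ x : ℝ, indicatorL2 t x =
    (Set.Ioc 0 t).indicator 1 x - (Set.Ioc t 0).indicator 1 x := by
  have h1 : (Set.Ioc 0 t).indicator (1 : ℝ → ℝ) =ᵐ[volume] (Set.Icc 0 t).indicator 1 :=
    indicator_ae_eq_of_ae_eq_set Ioc_ae_eq_Icc
  have h2 : (Set.Ioc t 0).indicator (1 : ℝ → ℝ) =ᵐ[volume] (Set.Icc t 0).indicator 1 :=
    indicator_ae_eq_of_ae_eq_set Ioc_ae_eq_Icc
  filter_upwards [h1, h2, Lp.coeFn_sub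
    (indicatorConstLp 2 (measurableSet_Icc (a := 0) (b := t)) measure_Icc_lt_top.ne (1 : ℝ))
    (indicatorConstLp 2 (measurableSet_Icc (a := t) (b := 0)) measure_Icc_lt_top.ne (1 : ℝ)),
    indicatorConstLp_coeFn (p := 2) (hs := measurableSet_Icc (a := 0) (b := t))
      (hμs := measure_Icc_lt_top.ne) (c := (1 : ℝ)) (μ := volume),
    indicatorConstLp_coeFn (p := 2) (hs := measurableSet_Icc (a := t) (b := 0))
      (hμs := measure_Icc_lt_top.ne) (c := (1 : ℝ)) (μ := volume)] with x e1 e2 e3 e4 e5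
  rw [indicatorL2, e3, Pi.sub_apply, e4, e5, e1, e2]
  rfl

theorem toComplexL2_indicatorL2_ae_eq (t : ℝ) : ∀ᵐ x : ℝ, toComplexL2 (indicatorL2 t) x =
    (Set.Ioc 0 t).indicator 1 x - (Set.Ioc t 0).indicator 1 x := by
  filter_upwards [indicatorL2_ae_eq t, Complex.ofRealCLM.coeFn_compLp (indicatorL2 t)] with x h1 h2
  rw [toComplexL2, h2, h1]
  simp only [Complex.ofRealCLM_apply, Complex.ofReal_sub, Set.indicator_apply, Pi.one_apply]
  split_ifs <;> simp

theorem integral_signed_indicator_mul (t : ℝ) {g : ℝ → ℂ} (hg : Continuous g) :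
    ∫ x, ((Set.Ioc 0 t).indicator 1 x - (Set.Ioc t 0).indicator 1 x) * g x = ∫ x in 0..t, g x := by
  have h : ∀ a b : ℝ, Integrable ((Set.Ioc a b).indicator g) := fun a b =>
    ((hg.integrableOn_Icc (a := a) (b := b)).mono_set Set.Ioc_subset_Icc_self).integrable_indicator
      measurableSet_Ioc
  have e : ∀ x, ((Set.Ioc 0 t).indicator 1 x - (Set.Ioc t 0).indicator 1 x) * g x =
      (Set.Ioc 0 t).indicator g x - (Set.Ioc t 0).indicator g x := by
    intro x
    simp only [Set.indicator_apply, Pi.one_apply]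
    split_ifs <;> simp
  simp only [e]
  rw [integral_sub (h 0 t) (h t 0), integral_indicator measurableSet_Ioc,
    integral_indicator measurableSet_Ioc, intervalIntegral]

theorem fourier_indicatorL2_ae_eq (t : ℝ) : ∀ᵐ ξ : ℝ,
    (𝓕 (toComplexL2 (indicatorL2 t)) : Lp ℂ 2 (volume : Measure ℝ)) ξ =
      ∫ x in 0..t, Complex.exp (-(Complex.I * (2 * Real.pi * ξ : ℝ) * x)) := by
  have hint : Integrable (toComplexL2 (indicatorL2 t)) := by
    have h : ∀ a b : ℝ, Integrable ((Set.Ioc a b).indicator (1 : ℝ → ℂ)) := fun a b =>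
      (integrable_indicator_iff measurableSet_Ioc).2 (integrableOn_const measure_Ioc_lt_top.ne)
    refine ((h 0 t).sub (h t 0)).congr ?_
    filter_upwards [toComplexL2_indicatorL2_ae_eq t] with x hx
    rw [hx, Pi.sub_apply]
  filter_upwards [fourier_L2_ae_eq _ hint] with ξ hξ
  rw [hξ, Real.fourier_real_eq_integral_exp_smul, ← integral_signed_indicator_mul t (by fun_prop)]
  refine integral_congr_ae ?_
  filter_upwards [toComplexL2_indicatorL2_ae_eq t] with x hx
  rw [hx, smul_eq_mul, mul_comm]
  congr 2
  push_cast
  ring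

theorem norm_integral_exp_sq (t u : ℝ) (hu : u ≠ 0) :
    ‖∫ x in 0..t, Complex.exp (-(Complex.I * u * x))‖ ^ 2 =
      ‖(Complex.exp (Complex.I * u * t) - 1) * (Complex.exp (-(Complex.I * u * t)) - 1) /
        (u : ℂ) ^ 2‖ := by
  have hc : -(Complex.I * (u : ℂ)) ≠ 0 := by simp [hu]
  have h := integral_exp_mul_complex (a := 0) (b := t) hc
  have e : ∀ x : ℝ, -(Complex.I * (u : ℂ)) * x = -(Complex.I * u * x) := fun x => by ring
  simp only [e] at h
  rw [h]
  have e2 : Complex.exp (Complex.I * u * t) - 1 =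
      (starRingEnd ℂ) (Complex.exp (-(Complex.I * u * t)) - 1) := by
    rw [map_sub, ← Complex.exp_conj]
    simp
  rw [norm_div, norm_div, norm_mul, e2, RCLike.norm_conj]
  simp [pow_two, div_mul_div_comm]

/-- The squared modulus of √m times the transform of 1_{[0,t]} is the modulus of the covariance
integrand at s = t, rescaled by u = 2πξ. -/
theorem inDomT_indicatorL2 {m : ℝ → ℝ} (hm : Measurable m) (hm_nonneg : ∀ u, 0 ≤ m u) (t : ℝ)
    (hcov : Integrable (fun u : ℝ =>
      (Complex.exp (Complex.I * u * t) - 1) * (Complex.exp (-(Complex.I * u * t)) - 1) /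
        (u : ℂ) ^ 2 * (m u : ℂ))) : InDomT m (indicatorL2 t) := by
  have hmeas : AEStronglyMeasurable (symbolMul m (indicatorL2 t)) volume := by
    refine AEStronglyMeasurable.mul ?_ (Lp.aestronglyMeasurable _)
    exact (Complex.measurable_ofReal.comp
      (hm.comp (measurable_const.mul measurable_id)).sqrt).aestronglyMeasurable
  rw [InDomT, memLp_two_iff_integrable_sq_norm hmeas]
  refine (hcov.comp_mul_left' (R := 2 * Real.pi) (by positivity)).norm.congr ?_
  have h0 : ∀ᵐ ξ : ℝ, ξ ≠ 0 := by simp [ae_iff]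
  filter_upwards [fourier_indicatorL2_ae_eq t, h0] with ξ h1 h2
  have e : ∀ z w : ℂ, ‖z * w‖ ^ 2 = ‖z‖ ^ 2 * ‖w‖ ^ 2 := fun z w => by rw [norm_mul, mul_pow]
  rw [symbolMul, h1, e, norm_integral_exp_sq _ _ (by positivity), norm_mul,
    Complex.norm_real, Complex.norm_real, Real.norm_of_nonneg (hm_nonneg _),
    Real.norm_of_nonneg (Real.sqrt_nonneg _), Real.sq_sqrt (hm_nonneg _), mul_comm]

/-- The Hermite functions as complex Schwartz functions. -/
def hermiteComplex (k : ℕ) : 𝓢(ℝ, ℂ) := (hermiteSchwartz k).postcompCLM Complex.ofRealCLM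

theorem hermiteComplex_apply (k : ℕ) (x : ℝ) : hermiteComplex k x = (hermiteFun k x : ℂ) := rfl

theorem fourier_hermiteComplex (k : ℕ) (ξ : ℝ) :
    (𝓕 (hermiteComplex k)) ξ = hat (hermiteFun k) (2 * Real.pi * ξ) := by
  rw [SchwartzMap.fourier_coe, Real.fourier_real_eq_integral_exp_smul, hat]
  refine integral_congr_ae (ae_of_all _ fun x => ?_)
  simp only [hermiteComplex_apply, smul_eq_mul]
  congr 2
  push_cast
  ring

/-- Parseval's identity; the real part can be taken outside the integral because the Hermite
functions are real. -/
theorem integral_re_mul_hermiteFun (G : Lp ℂ 2 (volume : Measure ℝ)) (k : ℕ) :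
    ∫ x, (Complex.reCLM.compLp (𝓕⁻ G : Lp ℂ 2 (volume : Measure ℝ))) x * hermiteFun k x =
      (∫ ξ, G ξ * (starRingEnd ℂ) (hat (hermiteFun k) (2 * Real.pi * ξ))).re := by
  set F : Lp ℂ 2 (volume : Measure ℝ) := 𝓕⁻ G with hF
  have hFG : 𝓕 F = G := FourierTransform.fourier_fourierInv_eq G
  have h1 : inner ℂ ((hermiteComplex k).toLp 2 volume) F = ∫ x, F x * (hermiteFun k x : ℂ) := by
    rw [L2.inner_def]
    refine integral_congr_ae ?_
    filter_upwards [(hermiteComplex k).coeFn_toLp 2 volume] with x hx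
    rw [hx, hermiteComplex_apply]
    simp
  have h2 : inner ℂ ((hermiteComplex k).toLp 2 volume) F =
      ∫ ξ, G ξ * (starRingEnd ℂ) (hat (hermiteFun k) (2 * Real.pi * ξ)) := by
    rw [← Lp.inner_fourier_eq, hFG, SchwartzMap.toLp_fourier_eq, L2.inner_def]
    refine integral_congr_ae ?_
    filter_upwards [(𝓕 (hermiteComplex k)).coeFn_toLp 2 volume] with x hx
    rw [hx, fourier_hermiteComplex]
    simp
  rw [← h2, h1]
  have hint : Integrable fun x => F x * (hermiteFun k x : ℂ) :=
    (Lp.memLp F).integrable_mul (μ := volume) ((hermiteComplex k).memLp 2 volume)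
  rw [← Complex.reCLM_apply, ← Complex.reCLM.integral_comp_comm hint]
  refine integral_congr_ae ?_
  filter_upwards [Complex.reCLM.coeFn_compLp F] with x hx
  rw [hx]
  simp

/-- The integrand is a complex conjugate, which does not affect the real part. Then Fubini applies,
and u = 2πξ produces the factor (2π)⁻¹. -/
theorem integral_integral_exp_mul {m : ℝ → ℝ} {k : ℕ} (h : Integrable (symbolHermite m k)) (t : ℝ) :
    (∫ ξ, (∫ x in 0..t, Complex.exp (-(Complex.I * (2 * Real.pi * ξ : ℝ) * x))) *
      (starRingEnd ℂ) (symbolHermite m k (2 * Real.pi * ξ))).re =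
      ∫ x in 0..t, opTValue m (hermiteSchwartz k) x := by
  have hS : Integrable fun ξ : ℝ => symbolHermite m k (2 * Real.pi * ξ) :=
    h.comp_mul_left' (by positivity)
  have e1 : ∀ ξ : ℝ, (∫ x in 0..t, Complex.exp (-(Complex.I * (2 * Real.pi * ξ : ℝ) * x))) *
      (starRingEnd ℂ) (symbolHermite m k (2 * Real.pi * ξ)) =
      (starRingEnd ℂ) (∫ x in 0..t, Complex.exp (Complex.I * (2 * Real.pi * ξ : ℝ) * x) *
        symbolHermite m k (2 * Real.pi * ξ)) := by
    intro ξ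
    have hc : (starRingEnd ℂ) (∫ x in 0..t, Complex.exp (Complex.I * (2 * Real.pi * ξ : ℝ) * x)) =
        ∫ x in 0..t, Complex.exp (-(Complex.I * (2 * Real.pi * ξ : ℝ) * x)) := by
      rw [← intervalIntegral.intervalIntegral_conj]
      refine intervalIntegral.integral_congr fun x _ => ?_
      simp only [← Complex.exp_conj, map_mul, Complex.conj_I, Complex.conj_ofReal, neg_mul]
    rw [intervalIntegral.integral_mul_const, map_mul, hc]
  simp only [e1]
  rw [integral_conj, Complex.conj_re]
  have hprod : Integrable (Function.uncurry fun (x ξ : ℝ) =>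
      Complex.exp (Complex.I * (2 * Real.pi * ξ : ℝ) * x) * symbolHermite m k (2 * Real.pi * ξ))
      ((volume.restrict (Set.uIoc 0 t)).prod volume) := by
    have : IsFiniteMeasure (volume.restrict (Set.uIoc 0 t)) := by
      unfold Set.uIoc
      infer_instance
    have h1 : Integrable (fun p : ℝ × ℝ => symbolHermite m k (2 * Real.pi * p.2))
        ((volume.restrict (Set.uIoc 0 t)).prod volume) := hS.comp_snd _
    refine (h1.bdd_mul (c := 1) (f := fun p : ℝ × ℝ =>
      Complex.exp (Complex.I * (2 * Real.pi * p.2 : ℝ) * p.1))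
      (Continuous.aestronglyMeasurable (by fun_prop))
      (ae_of_all _ fun p => (norm_exp_I_mul_mul _ _).le))
  rw [← intervalIntegral_integral_swap hprod]
  have e2 : ∀ x : ℝ, ∫ ξ, Complex.exp (Complex.I * (2 * Real.pi * ξ : ℝ) * x) *
      symbolHermite m k (2 * Real.pi * ξ) = (2 * Real.pi : ℂ)⁻¹ *
        ∫ u : ℝ, Complex.exp (Complex.I * u * x) * symbolHermite m k u := by
    intro x
    have := Measure.integral_comp_mul_left (fun u : ℝ =>
      Complex.exp (Complex.I * u * x) * symbolHermite m k u) (2 * Real.pi)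
    rw [abs_of_pos (by positivity), Complex.real_smul] at this
    rw [this]
    push_cast
    rfl
  simp only [e2]
  have hcont : Continuous fun x : ℝ => (2 * Real.pi : ℂ)⁻¹ *
      ∫ u : ℝ, Complex.exp (Complex.I * u * x) * symbolHermite m k u :=
    continuous_const.mul (continuous_integral_exp_mul h)
  simp only [opTValue_eq, ← Complex.reCLM_apply]
  exact (Complex.reCLM.intervalIntegral_comp_comm (hcont.intervalIntegrable 0 t)).symm

/-- The pairing of `T_m 1_{[0,t]}` with a Hermite function. -/
theorem integral_opT_indicatorL2_mul {m : ℝ → ℝ} {t : ℝ} (hdom : InDomT m (indicatorL2 t))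
    {k : ℕ} (h : Integrable (symbolHermite m k)) :
    ∫ x, opT m (indicatorL2 t) x * hermiteFun k x =
      ∫ x in 0..t, opTValue m (hermiteSchwartz k) x := by
  rw [opT, dif_pos hdom, integral_re_mul_hermiteFun, ← integral_integral_exp_mul h]
  congr 1
  refine integral_congr_ae ?_
  filter_upwards [MemLp.coeFn_toLp hdom, fourier_indicatorL2_ae_eq t] with ξ h1 h2
  rw [h1, symbolMul, h2, symbolHermite, map_mul, Complex.conj_ofReal]
  ring

/-- This is X_m' = W_m in integrated form. -/
theorem chaosCoeff_X_sub {P : Measure Omega} (hP : IsWhiteNoise P) {m : ℝ → ℝ} {s t : ℝ}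
    (hs : InDomT m (indicatorL2 s)) (ht : InDomT m (indicatorL2 t))
    (h : ∀ k, Integrable (symbolHermite m k)) :
    chaosCoeff P (X P m t - X P m s) =
      firstChaos fun k => ∫ x in s..t, opTValue m (hermiteSchwartz k) x := by
  have hsub : ∀ k, ∫ x in s..t, opTValue m (hermiteSchwartz k) x =
      (∫ x in 0..t, opTValue m (hermiteSchwartz k) x) -
        ∫ x in 0..s, opTValue m (hermiteSchwartz k) x := fun k =>
    (intervalIntegral.integral_interval_sub_left
      ((continuous_opTValue k (h k)).intervalIntegrable _ _)
      ((continuous_opTValue k (h k)).intervalIntegrable _ _)).symm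
  funext α
  rw [hP.chaosCoeff_sub, X, X, hP.chaosCoeff_Q, hP.chaosCoeff_Q]
  by_cases hα : ∃ k, α = Finsupp.single k 1
  · obtain ⟨k, rfl⟩ := hα
    simp only [firstChaos_single, integral_opT_indicatorL2_mul hs (h k),
      integral_opT_indicatorL2_mul ht (h k), hsub]
  · simp only [firstChaos_of_ne _ (not_exists.1 hα), sub_zero]

/-! ### Weights -/

theorem one_le_weight (p : ℕ) (α : Multiindex) : 1 ≤ weight p α :=
  Finset.prod_induction _ (fun x : ℝ => 1 ≤ x)
    (fun _ _ ha hb => one_le_mul_of_one_le_of_one_le ha hb) le_rfl fun j _ => one_le_pow₀ (by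
      have : (0 : ℝ) ≤ j := Nat.cast_nonneg j
      linarith)

theorem weight_add_left (p q : ℕ) (α : Multiindex) :
    weight (p + q) α = weight p α * weight q α := by
  simp only [weight, add_mul, pow_add, Finsupp.prod_mul]

theorem weight_add (p : ℕ) (α β : Multiindex) : weight p (α + β) = weight p α * weight p β :=
  Finsupp.prod_add_index' (by simp) (by intro j n k; rw [mul_add p, pow_add])

theorem weight_mono {p q : ℕ} (h : p ≤ q) (α : Multiindex) : weight p α ≤ weight q α := by
  obtain ⟨r, rfl⟩ := Nat.exists_eq_add_of_le h
  rw [weight_add_left]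
  exact le_mul_of_one_le_right (weight_pos p α).le (one_le_weight r α)

theorem weight_single (p k : ℕ) : weight p (Finsupp.single k 1) = (2 * ((k : ℝ) + 1)) ^ p := by
  simp [weight]

/-- For 0 ≤ x ≤ 1/2 one has 1/(1-x) ≤ 1 + 2x ≤ e^{2x}. -/
theorem geom_sum_le_exp {x : ℝ} (h0 : 0 ≤ x) (h1 : x ≤ 1 / 2) (T : Finset ℕ) :
    ∑ i ∈ T, x ^ i ≤ Real.exp (2 * x) := by
  have hx : x < 1 := by linarith
  refine ((summable_geometric_of_lt_one h0 hx).sum_le_tsum T fun i _ => by positivity).trans ?_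
  rw [tsum_geometric_of_lt_one h0 hx]
  refine le_trans ?_ (Real.add_one_le_exp _)
  rw [inv_le_iff_one_le_mul₀ (by linarith)]
  nlinarith

/-- A finite form of expanding ∏ 1/(1-x_j). The induction splits off the exponent at j, and enlarges
T to the product of its two projections so that the sum factorizes. -/
theorem sum_finsupp_prod_le_exp {x : ℕ → ℝ} (h0 : ∀ j, 0 ≤ x j) (h1 : ∀ j, x j ≤ 1 / 2)
    (S : Finset ℕ) (T : Finset Multiindex) (hT : ∀ α ∈ T, α.support ⊆ S) :
    ∑ α ∈ T, α.prod (fun j n => x j ^ n) ≤ Real.exp (∑ j ∈ S, 2 * x j) := by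
  classical
  induction S using Finset.induction_on generalizing T with
  | empty =>
    have hT' : T ⊆ {0} := fun α hα => by
      have := hT α hα
      simpa using this
    calc ∑ α ∈ T, α.prod (fun j n => x j ^ n)
        ≤ ∑ α ∈ ({0} : Finset Multiindex), α.prod (fun j n => x j ^ n) :=
          Finset.sum_le_sum_of_subset_of_nonneg hT' fun α _ _ =>
            Finset.prod_nonneg fun j _ => pow_nonneg (h0 j) _
      _ ≤ _ := by simp
  | insert j S hj ih =>
    have hprod : ∀ α : Multiindex, α.prod (fun j n => x j ^ n) =
        x j ^ α j * (α.erase j).prod (fun j n => x j ^ n) := fun α =>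
      (Finsupp.mul_prod_erase' α j _ (by simp)).symm
    have hinj : Set.InjOn (fun α : Multiindex => (α j, α.erase j)) T := by
      intro α _ β _ h
      simp only [Prod.mk.injEq] at h
      rw [← Finsupp.single_add_erase j α, ← Finsupp.single_add_erase j β, h.1, h.2]
    calc ∑ α ∈ T, α.prod (fun j n => x j ^ n)
        = ∑ y ∈ T.image (fun α : Multiindex => (α j, α.erase j)),
            x j ^ y.1 * y.2.prod (fun j n => x j ^ n) := by
          rw [Finset.sum_image hinj]
          exact Finset.sum_congr rfl fun α _ => hprod α
      _ ≤ ∑ y ∈ (T.image fun α => α j) ×ˢ (T.image fun α => α.erase j),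
            x j ^ y.1 * y.2.prod (fun j n => x j ^ n) := by
          refine Finset.sum_le_sum_of_subset_of_nonneg ?_ fun y _ _ =>
            mul_nonneg (pow_nonneg (h0 j) _) (Finset.prod_nonneg fun j _ => pow_nonneg (h0 j) _)
          intro y hy
          obtain ⟨α, hα, rfl⟩ := Finset.mem_image.1 hy
          exact Finset.mem_product.2
            ⟨Finset.mem_image_of_mem _ hα, Finset.mem_image_of_mem _ hα⟩
      _ = (∑ i ∈ T.image fun α => α j, x j ^ i) *
            ∑ β ∈ T.image fun α => α.erase j, β.prod (fun j n => x j ^ n) := by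
          rw [Finset.sum_mul_sum, Finset.sum_product]
      _ ≤ Real.exp (2 * x j) * Real.exp (∑ j ∈ S, 2 * x j) := by
          refine mul_le_mul (geom_sum_le_exp (h0 j) (h1 j) _) (ih _ fun β hβ => ?_)
            (Finset.sum_nonneg fun β _ => Finset.prod_nonneg fun j _ => pow_nonneg (h0 j) _)
            (Real.exp_pos _).le
          obtain ⟨α, hα, rfl⟩ := Finset.mem_image.1 hβ
          rw [Finsupp.support_erase]
          exact fun i hi => (Finset.mem_insert.1 (hT α hα (Finset.mem_of_mem_erase hi))).resolve_left
            (Finset.ne_of_mem_erase hi)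
      _ = _ := by rw [Finset.sum_insert hj, Real.exp_add]

/-- The numbers `(2ℕ)^{-2α}` are summable. -/
theorem summable_weight_inv : Summable fun α : Multiindex => (weight 2 α)⁻¹ := by
  classical
  set x : ℕ → ℝ := fun j => ((2 * ((j : ℝ) + 1)) ^ 2)⁻¹ with hx
  have h0 : ∀ j, 0 ≤ x j := fun j => by positivity
  have h1 : ∀ j, x j ≤ 1 / 2 := fun j => by
    have : (0 : ℝ) ≤ j := Nat.cast_nonneg j
    rw [hx, one_div]
    exact inv_anti₀ (by norm_num) (by nlinarith)
  have hs : Summable fun j => 2 * x j := by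
    have h := (Real.summable_nat_pow_inv (p := 2)).2 (by norm_num)
    have h2 := ((summable_nat_add_iff 1).2 h).mul_left (2 / 4)
    refine h2.congr fun j => ?_
    rw [hx]
    push_cast
    field_simp
    norm_num
  have hw : ∀ α, (weight 2 α)⁻¹ = α.prod (fun j n => x j ^ n) := fun α => by
    rw [weight, Finsupp.prod, Finsupp.prod, ← Finset.prod_inv_distrib]
    exact Finset.prod_congr rfl fun j _ => by rw [hx, pow_mul, inv_pow]
  refine summable_of_sum_le (c := Real.exp (∑' j, 2 * x j))
    (fun α => (inv_pos.2 (weight_pos 2 α)).le) fun T => ?_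
  simp only [hw]
  refine (sum_finsupp_prod_le_exp h0 h1 (T.biUnion Finsupp.support) T fun α hα =>
    Finset.subset_biUnion_of_mem _ hα).trans (Real.exp_le_exp.2 ?_)
  exact hs.sum_le_tsum _ fun j _ => by have := h0 j; positivity

/-! ### Sequences bounded by weights -/

/-- Of the exponent 2q + 2, the part 2q cancels the squared bound and the part 2 leaves a summable
weight. -/
theorem sq_mul_weight_inv_le {q : ℕ} {C g : ℝ} {α : Multiindex} (h : |g| ≤ C * weight q α) :
    g ^ 2 * (weight (2 * q + 2) α)⁻¹ ≤ C ^ 2 * (weight 2 α)⁻¹ := by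
  have hq := weight_pos q α
  have h2 := weight_pos 2 α
  have hsq : g ^ 2 ≤ (C * weight q α) ^ 2 := by
    rw [← sq_abs]
    exact pow_le_pow_left₀ (abs_nonneg g) h 2
  rw [weight_add_left, two_mul, weight_add_left]
  calc g ^ 2 * (weight q α * weight q α * weight 2 α)⁻¹
      ≤ (C * weight q α) ^ 2 * (weight q α * weight q α * weight 2 α)⁻¹ := by gcongr
    _ = C ^ 2 * (weight 2 α)⁻¹ := by field_simp

theorem inHDual_of_abs_le {q : ℕ} {C : ℝ} {g : Multiindex → ℝ}
    (h : ∀ α, |g α| ≤ C * weight q α) : InHDual (2 * q + 2) g :=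
  Summable.of_nonneg_of_le
    (fun α => mul_nonneg (sq_nonneg _) (inv_pos.2 (weight_pos _ α)).le)
    (fun α => sq_mul_weight_inv_le (h α)) (summable_weight_inv.mul_left (C ^ 2))

theorem InHDual.exists_abs_le {p : ℕ} {g : Multiindex → ℝ} (h : InHDual p g) :
    ∃ C : ℝ, ∀ α, |g α| ≤ C * weight p α := by
  set S := ∑' α, g α ^ 2 * (weight p α)⁻¹ with hS
  have hterm : ∀ α, 0 ≤ g α ^ 2 * (weight p α)⁻¹ := fun α =>
    mul_nonneg (sq_nonneg _) (inv_pos.2 (weight_pos _ α)).le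
  have hS0 : 0 ≤ S := tsum_nonneg hterm
  -- The constant S + 1 avoids a square root: S ≤ (S + 1)², and weights are at least 1.
  refine ⟨S + 1, fun α => abs_le_of_sq_le_sq ?_ (by have := weight_pos p α; positivity)⟩
  have h1 : g α ^ 2 * (weight p α)⁻¹ ≤ S := h.le_tsum α fun β _ => hterm β
  have hw := one_le_weight p α
  rw [← div_eq_mul_inv, div_le_iff₀ (weight_pos p α)] at h1
  have hw2 : weight p α ≤ weight p α ^ 2 := by nlinarith
  calc g α ^ 2 ≤ S * weight p α := h1
    _ ≤ (S + 1) ^ 2 * weight p α ^ 2 := by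
      refine mul_le_mul (by nlinarith) hw2 (by linarith) (by positivity)
    _ = _ := by ring

/-- The constant in the estimate for the Wick product. -/
def wickConst : ℝ := ∑' α : Multiindex, (weight 2 α)⁻¹

theorem wickConst_nonneg : 0 ≤ wickConst :=
  tsum_nonneg fun α => (inv_pos.2 (weight_pos 2 α)).le

/-- Weights are multiplicative along α + β = γ. Raising the exponent by 2 leaves a factor
(2ℕ)^{-2α}, which bounds the sum over all decompositions of γ. -/
theorem abs_wick_le {q : ℕ} {C D : ℝ} (hC : 0 ≤ C) (hD : 0 ≤ D) {f g : Multiindex → ℝ}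
    (hf : ∀ α, |f α| ≤ C * weight q α) (hg : ∀ α, |g α| ≤ D * weight q α) (γ : Multiindex) :
    |wick f g γ| ≤ C * D * wickConst * weight (q + 2) γ := by
  classical
  have hle : ∀ x ∈ Finset.HasAntidiagonal.antidiagonal γ, |f x.1 * g x.2| ≤
      C * D * weight (q + 2) γ * (weight 2 x.1)⁻¹ := by
    intro x hx
    have hx' : x.1 + x.2 = γ := Finset.HasAntidiagonal.mem_antidiagonal.1 hx
    have h1 := weight_pos q x.1
    have h2 := weight_pos q x.2
    have h3 := weight_pos 2 x.1
    have h4 := one_le_weight 2 x.2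
    rw [abs_mul, ← hx', weight_add_left, weight_add, weight_add]
    calc |f x.1| * |g x.2| ≤ (C * weight q x.1) * (D * weight q x.2) := by
          gcongr
          exacts [hf _, hg _]
      _ ≤ (C * weight q x.1) * (D * weight q x.2) * weight 2 x.2 :=
          le_mul_of_one_le_right (by positivity) h4
      _ = _ := by field_simp
  -- The first component determines the pair, so this is a partial sum of the series for
  -- `wickConst`.
  have hsum : ∑ x ∈ Finset.HasAntidiagonal.antidiagonal γ, (weight 2 x.1)⁻¹ ≤ wickConst := by
    have hinj : Set.InjOn (Prod.fst : Multiindex × Multiindex → Multiindex)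
        (Finset.HasAntidiagonal.antidiagonal γ : Finset (Multiindex × Multiindex)) := by
      intro x hx y hy hxy
      have hx' : x.1 + x.2 = γ := Finset.HasAntidiagonal.mem_antidiagonal.1 hx
      have hy' : y.1 + y.2 = γ := Finset.HasAntidiagonal.mem_antidiagonal.1 hy
      refine Prod.ext hxy (add_left_cancel (a := x.1) ?_)
      rw [hx', hxy, hy']
    rw [← Finset.sum_image (f := fun α : Multiindex => (weight 2 α)⁻¹) hinj]
    exact summable_weight_inv.sum_le_tsum _ fun α _ => (inv_pos.2 (weight_pos 2 α)).le
  refine (Finset.abs_sum_le_sum_abs _ _).trans ((Finset.sum_le_sum hle).trans ?_)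
  rw [← Finset.mul_sum]
  have := weight_pos (q + 2) γ
  calc _ ≤ C * D * weight (q + 2) γ * wickConst := by gcongr
    _ = _ := by ring

theorem abs_firstChaos_le {c : ℕ → ℝ} {C : ℝ} (hC : 0 ≤ C) {r : ℕ}
    (h : ∀ k, |c k| ≤ C * ((k : ℝ) + 1) ^ r) (α : Multiindex) :
    |firstChaos c α| ≤ C * weight r α := by
  by_cases hα : ∃ k, α = Finsupp.single k 1
  · obtain ⟨k, rfl⟩ := hα
    rw [firstChaos_single, weight_single]
    refine (h k).trans ?_
    gcongr
    linarith [(Nat.cast_nonneg k : (0 : ℝ) ≤ k)]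
  · rw [firstChaos_of_ne _ (not_exists.1 hα), abs_zero]
    exact mul_nonneg hC (weight_pos r α).le

/-! ### The norm of `ℋ_p'` -/

theorem HDual.coeff_sub {p : ℕ} (f g : HDual p) : (f - g).coeff = f.coeff - g.coeff := rfl

theorem HDual.norm_sq {p : ℕ} (g : HDual p) :
    ‖g‖ ^ 2 = ∑' α, g.coeff α ^ 2 * (weight p α)⁻¹ := by
  rw [HDual.norm_eq, Real.sq_sqrt]
  exact tsum_nonneg fun α => mul_nonneg (sq_nonneg _) (inv_pos.2 (weight_pos _ α)).le

/-- The coefficient functionals on `ℋ_p'`. -/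
def HDual.coeffCLM (p : ℕ) (γ : Multiindex) : HDual p →L[ℝ] ℝ :=
  LinearMap.mkContinuous
    { toFun := fun g => g.coeff γ
      map_add' := fun _ _ => rfl
      map_smul' := fun _ _ => rfl } (Real.sqrt (weight p γ)) (by
    intro g
    have hw := weight_pos p γ
    refine abs_le_of_sq_le_sq ?_ (by positivity)
    rw [mul_pow, Real.sq_sqrt hw.le, HDual.norm_sq]
    have h := g.inHDual.le_tsum γ fun β _ =>
      mul_nonneg (sq_nonneg (g.coeff β)) (inv_pos.2 (weight_pos p β)).le
    rw [← div_eq_mul_inv, div_le_iff₀ hw] at h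
    rw [mul_comm]
    exact h)

theorem HDual.coeffCLM_apply {p : ℕ} (γ : Multiindex) (g : HDual p) :
    HDual.coeffCLM p γ g = g.coeff γ := rfl

/-- On sets of sequences bounded by a weight, the norm of `ℋ_p'` for large `p` is small as soon as
finitely many coefficients are small. -/
theorem HDual.exists_finset_norm_lt (q : ℕ) (C : ℝ) {ε : ℝ} (hε : 0 < ε) :
    ∃ S : Finset Multiindex, ∃ η : ℝ, 0 < η ∧ ∀ g : HDual (2 * q + 2),
      (∀ γ, |g.coeff γ| ≤ C * weight q γ) → (∀ γ ∈ S, |g.coeff γ| ≤ η) → ‖g‖ < ε := by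
  have hsum := summable_weight_inv.mul_left (C ^ 2)
  have ht := tendsto_tsum_compl_atTop_zero fun α : Multiindex => C ^ 2 * (weight 2 α)⁻¹
  obtain ⟨S, hS⟩ := (ht.eventually (gt_mem_nhds (show 0 < ε ^ 2 / 2 by positivity))).exists
  -- The indices in S then contribute at most ε²/4 to the squared norm, and the others less than
  -- ε²/2.
  refine ⟨S, ε / (2 * (S.card + 1)), by positivity, fun g hg hgS => ?_⟩
  refine lt_of_pow_lt_pow_left₀ 2 hε.le ?_
  rw [HDual.norm_sq, ← g.inHDual.sum_add_tsum_compl (s := S)]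
  have h1 : ∑ α ∈ S, g.coeff α ^ 2 * (weight (2 * q + 2) α)⁻¹ ≤ ε ^ 2 / 4 := by
    have hle : ∀ α ∈ S, g.coeff α ^ 2 * (weight (2 * q + 2) α)⁻¹ ≤
        (ε / (2 * (S.card + 1))) ^ 2 := fun α hα => by
      have hs : g.coeff α ^ 2 ≤ (ε / (2 * (S.card + 1))) ^ 2 := by
        rw [← sq_abs]
        exact pow_le_pow_left₀ (abs_nonneg _) (hgS α hα) 2
      exact (mul_le_of_le_one_right (sq_nonneg _)
        (inv_le_one_of_one_le₀ (one_le_weight _ α))).trans hs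
    refine (Finset.sum_le_card_nsmul _ _ _ hle).trans ?_
    rw [nsmul_eq_mul]
    have hc : (0 : ℝ) ≤ S.card := Nat.cast_nonneg _
    rw [div_pow, mul_pow, mul_div_assoc', div_le_div_iff₀ (by positivity) (by norm_num)]
    have : (S.card : ℝ) * 4 ≤ 2 ^ 2 * ((S.card : ℝ) + 1) ^ 2 := by nlinarith
    have h2 := mul_le_mul_of_nonneg_left this (sq_nonneg ε)
    linarith
  have h2 : ∑' α : ((S : Set Multiindex)ᶜ : Set Multiindex),
      g.coeff α ^ 2 * (weight (2 * q + 2) α)⁻¹ ≤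
      ∑' α : ((S : Set Multiindex)ᶜ : Set Multiindex), C ^ 2 * (weight 2 α)⁻¹ :=
    Summable.tsum_le_tsum (fun α => sq_mul_weight_inv_le (hg α))
      (g.inHDual.subtype _) (hsum.subtype _)
  have h3 : ∑' α : ((S : Set Multiindex)ᶜ : Set Multiindex), C ^ 2 * (weight 2 (α : Multiindex))⁻¹
      < ε ^ 2 / 2 := hS
  have := sq_pos_of_pos hε
  linarith

/-! ### Continuous functions with values in `S_{-1}` -/

theorem mfactorial_pos (α : Multiindex) : 0 < mfactorial α :=
  Finset.prod_pos fun _ _ => Nat.cast_pos.2 (Nat.factorial_pos _)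

open scoped Classical in
/-- The test function `c H_α`. -/
def TestFunction.single (α : Multiindex) (c : ℝ) : TestFunction where
  coeff := Pi.single α c
  mem p _ := summable_of_ne_finset_zero (s := {α}) fun β hβ => by
    rw [Pi.single_eq_of_ne (by simpa using hβ)]
    ring

theorem TestFunction.single_coeff_self (α : Multiindex) (c : ℝ) :
    (TestFunction.single α c).coeff α = c := by simp [TestFunction.single]

theorem TestFunction.single_coeff_of_ne {α β : Multiindex} (h : β ≠ α) (c : ℝ) :
    (TestFunction.single α c).coeff β = 0 := by simp [TestFunction.single, h]

theorem TestFunction.pnorm_single (p : ℕ) (α : Multiindex) (c : ℝ) :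
    (TestFunction.single α c).pnorm p = mfactorial α * |c| * Real.sqrt (weight p α) := by
  have h : ∑' β, mfactorial β ^ 2 * (TestFunction.single α c).coeff β ^ 2 * weight p β =
      (mfactorial α * |c|) ^ 2 * weight p α := by
    rw [tsum_eq_single α fun β hβ => by
      rw [TestFunction.single_coeff_of_ne hβ]
      ring]
    rw [TestFunction.single_coeff_self, mul_pow, sq_abs]
  rw [TestFunction.pnorm, h, Real.sqrt_mul (sq_nonneg _),
    Real.sqrt_sq (mul_nonneg (mfactorial_pos α).le (abs_nonneg c))]

theorem pairing_single (G : StochDist) (α : Multiindex) (c : ℝ) :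
    pairing G (TestFunction.single α c) = mfactorial α * c * G.coeff α := by
  rw [pairing, tsum_eq_single α fun β hβ => by
    rw [TestFunction.single_coeff_of_ne hβ]
    ring]
  rw [TestFunction.single_coeff_self]

theorem exists_forall_le_of_forall_ge {f : ℕ → ℝ} {N : ℕ} {C : ℝ} (h : ∀ n, N ≤ n → f n ≤ C) :
    ∃ C', ∀ n, f n ≤ C' := by
  refine ⟨|C| + ∑ i ∈ Finset.range N, |f i|, fun n => ?_⟩
  have h0 : 0 ≤ ∑ i ∈ Finset.range N, |f i| := Finset.sum_nonneg fun i _ => abs_nonneg _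
  rcases le_or_gt N n with hn | hn
  · linarith [h n hn, le_abs_self C]
  · have := Finset.single_le_sum (f := fun i => |f i|) (fun i _ => abs_nonneg _)
      (Finset.mem_range.2 hn)
    linarith [le_abs_self (f n), abs_nonneg C]

section Continuous

variable {Y : ℝ → StochDist} {s : Set ℝ}

theorem tendstoUniformlyOn_pairing (hY : ContinuousOn Y s) {B : Set TestFunction}
    (hB : B ∈ boundedSets) {t : ℝ} (ht : t ∈ s) :
    TendstoUniformlyOn (fun t F => pairing (Y t) F) (fun F => pairing (Y t) F) (𝓝[s] t) B := by
  have hc : Continuous fun G : StochDist =>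
      UniformOnFun.ofFun boundedSets (fun F => pairing G F) := continuous_induced_dom
  exact UniformOnFun.tendsto_iff_tendstoUniformlyOn.1
    (hc.continuousAt.comp_continuousWithinAt (hY t ht)) B hB

/-- The coefficient is the pairing with H_α / α!, and a single test function is a bounded set. -/
theorem continuousOn_coeff (hY : ContinuousOn Y s) (α : Multiindex) :
    ContinuousOn (fun t => (Y t).coeff α) s := by
  intro t ht
  have hB : {TestFunction.single α (mfactorial α)⁻¹} ∈ boundedSets := fun p _ =>
    ⟨_, fun F hF => by rw [Set.mem_singleton_iff.1 hF]⟩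
  have h := (tendstoUniformlyOn_pairing hY hB ht).tendsto_at (Set.mem_singleton _)
  simp only [pairing_single, mul_inv_cancel₀ (mfactorial_pos α).ne', one_mul] at h
  exact h

/-- Near each t the pairings differ from those of Y(t) by less than 1 uniformly on B; compactness
makes the local bounds global. -/
theorem exists_abs_pairing_le (hs : IsCompact s) (hY : ContinuousOn Y s) {B : Set TestFunction}
    (hB : B ∈ boundedSets) (hbdd : ∀ G : StochDist, ∃ C, ∀ F ∈ B, |pairing G F| ≤ C) :
    ∃ C, ∀ t ∈ s, ∀ F ∈ B, |pairing (Y t) F| ≤ C := by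
  refine hs.induction_on (p := fun u => ∃ C, ∀ t ∈ u, ∀ F ∈ B, |pairing (Y t) F| ≤ C)
    ⟨0, by simp⟩ (fun u v huv ⟨C, hC⟩ => ⟨C, fun t ht => hC t (huv ht)⟩) ?_ ?_
  · rintro u v ⟨C, hC⟩ ⟨D, hD⟩
    exact ⟨max C D, fun t ht F hF => ht.elim
      (fun h => (hC t h F hF).trans (le_max_left _ _))
      (fun h => (hD t h F hF).trans (le_max_right _ _))⟩
  · intro t ht
    obtain ⟨C, hC⟩ := hbdd (Y t)
    have h := Metric.tendstoUniformlyOn_iff.1 (tendstoUniformlyOn_pairing hY hB ht) 1 one_pos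
    refine ⟨_, h, C + 1, fun r hr F hF => ?_⟩
    have h1 := hr F hF
    rw [Real.dist_eq] at h1
    have h2 := hC F hF
    rw [abs_lt] at h1
    rw [abs_le] at h2 ⊢
    constructor <;> linarith

/-- A continuous function from a compact set to `S_{-1}` is bounded by one of the weights. -/
theorem exists_abs_coeff_le (hs : IsCompact s) (hY : ContinuousOn Y s) :
    ∃ q : ℕ, ∃ C : ℝ, 0 ≤ C ∧ ∀ t ∈ s, ∀ α, |(Y t).coeff α| ≤ C * weight q α := by
  by_contra hcon
  push Not at hcon
  -- With q = C = n, failure of the claim yields a time and an index where the coefficient exceeds n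
  -- times the weight of order n.
  choose t hts α hα using fun n : ℕ => hcon n n (Nat.cast_nonneg n)
  -- Scaled so that the pairing is the coefficient divided by the weight of order n. The p-norm is
  -- then at most 1 for n ≥ p, so the sequence is bounded in every norm.
  set F : ℕ → TestFunction := fun n =>
    TestFunction.single (α n) ((mfactorial (α n))⁻¹ * (weight n (α n))⁻¹) with hF
  have hpair : ∀ (G : StochDist) (n : ℕ),
      pairing G (F n) = (weight n (α n))⁻¹ * G.coeff (α n) := by
    intro G n
    rw [hF, pairing_single, mul_inv_cancel_left₀ (mfactorial_pos _).ne']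
  have hB : Set.range F ∈ boundedSets := by
    intro p _
    have h1 : ∀ n, p ≤ n → (F n).pnorm p ≤ 1 := by
      intro n hn
      have hw := weight_pos n (α n)
      rw [hF, TestFunction.pnorm_single, abs_mul,
        abs_of_pos (inv_pos.2 (mfactorial_pos (α n))), abs_of_pos (inv_pos.2 hw),
        mul_inv_cancel_left₀ (mfactorial_pos _).ne', inv_mul_le_one₀ hw]
      refine Real.sqrt_le_iff.2 ⟨hw.le, (weight_mono hn _).trans ?_⟩
      have := one_le_weight n (α n)
      nlinarith
    obtain ⟨C, hC⟩ := exists_forall_le_of_forall_ge h1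
    exact ⟨C, by rintro _ ⟨n, rfl⟩; exact hC n⟩
  have hbdd : ∀ G : StochDist, ∃ C, ∀ f ∈ Set.range F, |pairing G f| ≤ C := by
    intro G
    obtain ⟨p, _, hp⟩ := G.mem
    obtain ⟨C, hC⟩ := hp.exists_abs_le
    have h1 : ∀ n, p ≤ n → |pairing G (F n)| ≤ |C| := by
      intro n hn
      have hw := weight_pos n (α n)
      rw [hpair, abs_mul, abs_of_pos (inv_pos.2 hw), inv_mul_le_iff₀ hw, mul_comm]
      refine (hC _).trans ?_
      have h2 := weight_mono hn (α n)
      have h3 := weight_pos p (α n)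
      have h4 := le_abs_self C
      have h5 := abs_nonneg C
      gcongr
    obtain ⟨C', hC'⟩ := exists_forall_le_of_forall_ge h1
    exact ⟨C', by rintro _ ⟨n, rfl⟩; exact hC' n⟩
  obtain ⟨C, hC⟩ := exists_abs_pairing_le hs hY hB hbdd
  obtain ⟨n, hn⟩ := exists_nat_gt C
  have h1 := hC (t n) (hts n) (F n) ⟨n, rfl⟩
  have hw := weight_pos n (α n)
  rw [hpair, abs_mul, abs_of_pos (inv_pos.2 hw), inv_mul_le_iff₀ hw, mul_comm] at h1
  have h2 := hα n
  nlinarith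

end Continuous

/-! ### Riemann sums -/

theorem partition_mem_Icc {a b : ℝ} {n : ℕ} {τ : ℕ → ℝ} (h0 : τ 0 = a) (hn : τ n = b)
    (hτ : ∀ k < n, τ k ≤ τ (k + 1)) {k : ℕ} (hk : k ≤ n) : τ k ∈ Set.Icc a b := by
  have hmono : ∀ j ≤ n, ∀ i ≤ j, τ i ≤ τ j := by
    intro j
    induction j with
    | zero => intro _ i hi; rw [Nat.le_zero.1 hi]
    | succ j ih =>
      intro hj i hi
      rcases Nat.le_succ_iff.1 hi with h | h
      · exact (ih (by omega) i h).trans (hτ j (by omega))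
      · rw [h]
  exact ⟨h0 ▸ hmono k hk 0 (Nat.zero_le k), hn ▸ hmono n le_rfl k hk⟩

/-- The first variable of φ is the time of Y, frozen at the left endpoint in the sum; the second is
the time of W_m. The local errors M (τ_{k+1} - τ_k) telescope. -/
theorem abs_integral_diag_sub_sum_le {φ : ℝ → ℝ → ℝ} {a b M : ℝ} {n : ℕ} {τ : ℕ → ℝ}
    (h0 : τ 0 = a) (hn : τ n = b) (hτ : ∀ k < n, τ k ≤ τ (k + 1))
    (hdiag : ContinuousOn (fun s => φ s s) (Set.Icc a b))
    (hrow : ∀ t ∈ Set.Icc a b, ContinuousOn (φ t) (Set.Icc a b))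
    (hM : ∀ k < n, ∀ s ∈ Set.Icc (τ k) (τ (k + 1)), |φ s s - φ (τ k) s| ≤ M) :
    |(∫ s in a..b, φ s s) - ∑ k ∈ Finset.range n, ∫ s in τ k..τ (k + 1), φ (τ k) s| ≤
      M * (b - a) := by
  have hmem : ∀ k ≤ n, τ k ∈ Set.Icc a b := fun k hk => partition_mem_Icc h0 hn hτ hk
  have hsub : ∀ k < n, Set.Icc (τ k) (τ (k + 1)) ⊆ Set.Icc a b := fun k hk =>
    Set.Icc_subset_Icc (hmem k hk.le).1 (hmem (k + 1) hk).2
  have hi1 : ∀ k < n, IntervalIntegrable (fun s => φ s s) volume (τ k) (τ (k + 1)) :=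
    fun k hk => (hdiag.mono (hsub k hk)).intervalIntegrable_of_Icc (hτ k hk)
  have hi2 : ∀ k < n, IntervalIntegrable (φ (τ k)) volume (τ k) (τ (k + 1)) :=
    fun k hk => ((hrow _ (hmem k hk.le)).mono (hsub k hk)).intervalIntegrable_of_Icc (hτ k hk)
  have hsum := intervalIntegral.sum_integral_adjacent_intervals hi1
  rw [h0, hn] at hsum
  rw [← hsum, ← Finset.sum_sub_distrib]
  have htel : ∑ k ∈ Finset.range n, M * (τ (k + 1) - τ k) = M * (b - a) := by
    rw [← Finset.mul_sum, Finset.sum_range_sub, h0, hn]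
  rw [← htel]
  refine (Finset.abs_sum_le_sum_abs _ _).trans (Finset.sum_le_sum fun k hk => ?_)
  have hk' := Finset.mem_range.1 hk
  rw [← intervalIntegral.integral_sub (hi1 k hk') (hi2 k hk')]
  have hle := intervalIntegral.norm_integral_le_of_norm_le_const (a := τ k) (b := τ (k + 1))
    (C := M) (f := fun s => φ s s - φ (τ k) s) fun s hs => by
      rw [Set.uIoc_of_le (hτ k hk')] at hs
      exact hM k hk' s (Set.Ioc_subset_Icc_self hs)
  rwa [abs_of_nonneg (sub_nonneg.2 (hτ k hk'))] at hle

theorem exists_delta_of_continuousOn {φ : ℝ → ℝ → ℝ} {a b η : ℝ} (hη : 0 < η)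
    (h : ContinuousOn (Function.uncurry φ) (Set.Icc a b ×ˢ Set.Icc a b)) :
    ∃ δ : ℝ, 0 < δ ∧ ∀ s ∈ Set.Icc a b, ∀ t ∈ Set.Icc a b, |s - t| < δ →
      |φ s s - φ t s| ≤ η := by
  have hu := (isCompact_Icc.prod isCompact_Icc).uniformContinuousOn_of_continuous h
  obtain ⟨δ, hδ, hd⟩ := Metric.uniformContinuousOn_iff.1 hu η hη
  refine ⟨δ, hδ, fun s hs t ht hst => ?_⟩
  have := hd (s, s) ⟨hs, hs⟩ (t, s) ⟨ht, hs⟩ (by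
    rw [Prod.dist_eq, dist_self, max_eq_left dist_nonneg, Real.dist_eq]
    exact hst)
  rw [Real.dist_eq] at this
  exact this.le

/-- Each Wick coefficient is a finite sum, linear in the second factor, so it commutes with the
integral. -/
theorem wick_firstChaos_integral (f : Multiindex → ℝ) {c : ℕ → ℝ → ℝ} (hc : ∀ k, Continuous (c k))
    (u v : ℝ) (γ : Multiindex) :
    wick f (firstChaos fun k => ∫ s in u..v, c k s) γ =
      ∫ s in u..v, wick f (firstChaos fun k => c k s) γ := by
  have hcont : ∀ β, Continuous fun s => firstChaos (fun k => c k s) β := fun β =>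
    continuous_finsetSum _ fun k _ => by
      split_ifs
      exacts [hc k, continuous_const]
  have hint : ∀ β, firstChaos (fun k => ∫ s in u..v, c k s) β =
      ∫ s in u..v, firstChaos (fun k => c k s) β := by
    intro β
    by_cases hβ : ∃ k, β = Finsupp.single k 1
    · obtain ⟨k, rfl⟩ := hβ
      simp only [firstChaos_single]
    · simp only [firstChaos_of_ne _ (not_exists.1 hβ), intervalIntegral.integral_zero]
  simp only [wick, hint]
  rw [intervalIntegral.integral_finsetSum fun x _ =>
    ((hcont x.2).const_mul (f x.1)).intervalIntegrable u v]
  simp only [intervalIntegral.integral_const_mul]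

/-- The element of `ℋ_p'` with given coefficients. -/
def HDual.mk {p : ℕ} (g : Multiindex → ℝ) (h : InHDual p g) : HDual p := ⟨g, h⟩

theorem HDual.coeff_mk {p : ℕ} (g : Multiindex → ℝ) (h : InHDual p g) :
    (HDual.mk g h).coeff = g := rfl

/-- The common weight bound makes the tails uniformly small, so continuity of finitely many
coefficients suffices. -/
theorem HDual.continuousOn_of_coeff {q : ℕ} {C : ℝ} {Z : ℝ → HDual (2 * q + 2)} {s : Set ℝ}
    (hb : ∀ t ∈ s, ∀ γ, |(Z t).coeff γ| ≤ C * weight q γ)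
    (hc : ∀ γ, ContinuousOn (fun t => (Z t).coeff γ) s) : ContinuousOn Z s := by
  intro t ht
  refine Metric.tendsto_nhds.2 fun ε hε => ?_
  obtain ⟨S, η, hη, h⟩ := HDual.exists_finset_norm_lt q (2 * C) hε
  have hS : ∀ᶠ r in 𝓝[s] t, ∀ γ ∈ S, |(Z r).coeff γ - (Z t).coeff γ| ≤ η := by
    rw [Finset.eventually_all]
    intro γ _
    filter_upwards [Metric.tendsto_nhds.1 (hc γ t ht) η hη] with r hr
    rw [Real.dist_eq] at hr
    exact hr.le
  filter_upwards [hS, self_mem_nhdsWithin] with r hr hrs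
  rw [dist_eq_norm]
  refine h _ (fun γ => ?_) fun γ hγ => hr γ hγ
  rw [HDual.coeff_sub, Pi.sub_apply]
  refine (abs_sub _ _).trans ?_
  linarith [hb r hrs γ, hb t ht γ]

end WickIto

end

/-! ### Convergence of the Riemann sums -/

theorem theorem5p1
    (P : MeasureTheory.Measure WickIto.Omega) (hP : WickIto.IsWhiteNoise P)
    (m : ℝ → ℝ) (hm_meas : Measurable m) (hm_nonneg : ∀ u, 0 ≤ m u)
    (hm_even : ∀ u, m (-u) = m u)
    (K β : ℝ) (N : ℕ) (hK : 0 < K) (hβ : β < 2)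
    (hm_small : ∀ u : ℝ, 0 < |u| → |u| ≤ 1 → m u ≤ K * |u| ^ (-β))
    (hm_large : ∀ u : ℝ, 1 < |u| → m u ≤ K * |u| ^ (2 * N))
    -- the covariance function of the process is given by convergent integrals
    (hm_cov : ∀ t s : ℝ, MeasureTheory.Integrable (fun u : ℝ =>
      (Complex.exp (Complex.I * u * t) - 1) * (Complex.exp (-(Complex.I * u * s)) - 1) /
        (u : ℂ) ^ 2 * (m u : ℂ)))
    (a b : ℝ) (hab : a ≤ b)
    (Y : ℝ → WickIto.StochDist) (hY : ContinuousOn Y (Set.Icc a b)) :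
    ∃ p : ℕ, 1 ≤ p ∧ ∃ Z : ℝ → WickIto.HDual p,
      (∀ t ∈ Set.Icc a b, (Z t).coeff = WickIto.wick (Y t).coeff (WickIto.W m t)) ∧
      ContinuousOn Z (Set.Icc a b) ∧
      ∀ ε : ℝ, 0 < ε → ∃ δ : ℝ, 0 < δ ∧
        ∀ (n : ℕ) (τ : ℕ → ℝ), τ 0 = a → τ n = b → (∀ k < n, τ k < τ (k + 1)) →
          (∀ k < n, τ (k + 1) - τ k < δ) →
          ∃ R : WickIto.HDual p,
            R.coeff = ∑ k ∈ Finset.range n, WickIto.wick (Y (τ k)).coeff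
              (WickIto.chaosCoeff P (WickIto.X P m (τ (k + 1)) - WickIto.X P m (τ k))) ∧
            ‖(∫ t in a..b, Z t) - R‖ < ε := by
  classical
  obtain ⟨hint, D, hD, r, hDr⟩ :=
    WickIto.exists_abs_opTValue_le hm_meas hK hβ hm_small hm_large
  obtain ⟨q₁, C, hC, hCY⟩ := WickIto.exists_abs_coeff_le isCompact_Icc hY
  set q := max q₁ r with hq
  have hYq : ∀ t ∈ Set.Icc a b, ∀ α, |(Y t).coeff α| ≤ C * WickIto.weight q α := fun t ht α =>
    (hCY t ht α).trans
      (mul_le_mul_of_nonneg_left (WickIto.weight_mono (le_max_left _ _) α) hC)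
  have hWq : ∀ t α, |WickIto.W m t α| ≤ D * WickIto.weight q α := fun t α =>
    (WickIto.abs_firstChaos_le hD (fun k => hDr k t) α).trans
      (mul_le_mul_of_nonneg_left (WickIto.weight_mono (le_max_right _ _) α) hD)
  have hopc : ∀ k, Continuous (WickIto.opTValue m (WickIto.hermiteSchwartz k)) :=
    fun k => WickIto.continuous_opTValue k (hint k)
  have hWc : ∀ α, Continuous fun t => WickIto.W m t α := fun α =>
    continuous_finsetSum _ fun k _ => by
      split_ifs
      exacts [hopc k, continuous_const]
  -- The times of Y and of W_m are separated: the integral uses the diagonal, the Riemann sum uses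
  -- rows.
  set φ : WickIto.Multiindex → ℝ → ℝ → ℝ := fun γ t s =>
    WickIto.wick (Y t).coeff (WickIto.W m s) γ with hφ
  set A := C * D * WickIto.wickConst with hA
  have hA0 : 0 ≤ A := mul_nonneg (mul_nonneg hC hD) WickIto.wickConst_nonneg
  have hφle : ∀ t ∈ Set.Icc a b, ∀ s γ, |φ γ t s| ≤ A * WickIto.weight (q + 2) γ :=
    fun t ht s γ => WickIto.abs_wick_le hC hD (hYq t ht) (hWq s) γ
  have hφc : ∀ γ, ContinuousOn (Function.uncurry (φ γ)) (Set.Icc a b ×ˢ Set.Icc a b) := fun γ =>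
    continuousOn_finsetSum _ fun x _ =>
      ((WickIto.continuousOn_coeff hY x.1).comp continuousOn_fst fun y hy => hy.1).mul
        ((hWc x.2).comp continuous_snd).continuousOn
  have hdiag : ∀ γ, ContinuousOn (fun s => φ γ s s) (Set.Icc a b) := fun γ =>
    (hφc γ).comp (continuousOn_id.prodMk continuousOn_id) fun s hs => ⟨hs, hs⟩
  have hrow : ∀ γ, ∀ t ∈ Set.Icc a b, ContinuousOn (φ γ t) (Set.Icc a b) := fun γ t ht =>
    (hφc γ).comp (continuousOn_const.prodMk continuousOn_id) fun s hs => ⟨ht, hs⟩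
  -- The Wick product raises the weight exponent to q + 2; membership in ℋ_p' doubles it and adds 2.
  set p := 2 * (q + 2) + 2 with hp
  -- The default 0 is never taken on [a,b], where the weight bound gives membership.
  set Z : ℝ → WickIto.HDual p := fun t =>
    if h : WickIto.InHDual p (fun γ => φ γ t t) then WickIto.HDual.mk _ h else 0 with hZ
  have hZcoeff : ∀ t ∈ Set.Icc a b, (Z t).coeff = fun γ => φ γ t t := by
    intro t ht
    rw [hZ]
    simp only
    rw [dif_pos (WickIto.inHDual_of_abs_le (hφle t ht t)), WickIto.HDual.coeff_mk]
  have hZc : ContinuousOn Z (Set.Icc a b) := by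
    refine WickIto.HDual.continuousOn_of_coeff (C := A) (fun t ht γ => ?_) fun γ => ?_
    · rw [hZcoeff t ht]
      exact hφle t ht t γ
    · exact (hdiag γ).congr fun t ht => by rw [hZcoeff t ht]
  have hZint : ∀ γ, (∫ t in a..b, Z t).coeff γ = ∫ t in a..b, φ γ t t := by
    intro γ
    have h := (WickIto.HDual.coeffCLM p γ).intervalIntegral_comp_comm
      (hZc.intervalIntegrable_of_Icc (μ := MeasureTheory.volume) hab)
    rw [← WickIto.HDual.coeffCLM_apply, ← h]
    refine intervalIntegral.integral_congr fun t ht => ?_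
    rw [Set.uIcc_of_le hab] at ht
    simp only [WickIto.HDual.coeffCLM_apply, hZcoeff t ht]
  refine ⟨p, by omega, Z, hZcoeff, hZc, fun ε hε => ?_⟩
  obtain ⟨S, η, hη, hS⟩ := WickIto.HDual.exists_finset_norm_lt (q + 2) (2 * A * (b - a)) hε
  have hba : 0 ≤ b - a := sub_nonneg.2 hab
  -- The added 1 covers the case a = b.
  have hη' : 0 < η / (b - a + 1) := by positivity
  choose δ hδ hδS using fun γ => WickIto.exists_delta_of_continuousOn hη' (hφc γ)
  -- A single mesh size serves all γ in the finite set S.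
  have hδev : ∀ᶠ d in nhdsWithin (0 : ℝ) (Set.Ioi 0), ∀ γ ∈ S, d ≤ δ γ := by
    rw [Finset.eventually_all]
    intro γ _
    filter_upwards [Ioo_mem_nhdsGT (hδ γ)] with d hd using hd.2.le
  obtain ⟨d, hdS, hd⟩ := (hδev.and self_mem_nhdsWithin).exists
  refine ⟨d, hd, fun n τ h0 hn hτ hmesh => ?_⟩
  have hτ' : ∀ k < n, τ k ≤ τ (k + 1) := fun k hk => (hτ k hk).le
  have hmem : ∀ k ≤ n, τ k ∈ Set.Icc a b := fun k hk => WickIto.partition_mem_Icc h0 hn hτ' hk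
  have hsub : ∀ k < n, Set.Icc (τ k) (τ (k + 1)) ⊆ Set.Icc a b := fun k hk =>
    Set.Icc_subset_Icc (hmem k hk.le).1 (hmem (k + 1) hk).2
  set E : WickIto.Multiindex → ℝ := fun γ => (∫ s in a..b, φ γ s s) -
    ∑ k ∈ Finset.range n, ∫ s in τ k..τ (k + 1), φ γ (τ k) s with hE
  have hEle : ∀ γ, |E γ| ≤ 2 * A * (b - a) * WickIto.weight (q + 2) γ := by
    intro γ
    refine (WickIto.abs_integral_diag_sub_sum_le (M := 2 * A * WickIto.weight (q + 2) γ) h0 hn hτ'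
      (hdiag γ) (hrow γ) fun k hk s hs => ?_).trans_eq (by ring)
    refine (abs_sub _ _).trans ?_
    linarith [hφle s (hsub k hk hs) s γ, hφle (τ k) (hmem k hk.le) s γ]
  have hES : ∀ γ ∈ S, |E γ| ≤ η := by
    intro γ hγ
    refine (WickIto.abs_integral_diag_sub_sum_le (M := η / (b - a + 1)) h0 hn hτ'
      (hdiag γ) (hrow γ) fun k hk s hs => hδS γ s (hsub k hk hs) (τ k) (hmem k hk.le) ?_).trans ?_
    · rw [abs_of_nonneg (sub_nonneg.2 hs.1)]
      linarith [hs.2, hmesh k hk, hdS γ hγ]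
    · rw [div_mul_eq_mul_div, div_le_iff₀ (by positivity)]
      nlinarith
  have hEmem : WickIto.InHDual p E := WickIto.inHDual_of_abs_le hEle
  -- The Riemann sum is realized as integral minus error, so its membership in ℋ_p' follows from the
  -- weight bound on E.
  refine ⟨(∫ t in a..b, Z t) - WickIto.HDual.mk E hEmem, ?_, ?_⟩
  · funext γ
    rw [WickIto.HDual.coeff_sub, WickIto.HDual.coeff_mk, Pi.sub_apply, hZint, Finset.sum_apply, hE]
    simp only
    rw [sub_sub_cancel]
    refine Finset.sum_congr rfl fun k _ => ?_
    have hdom : ∀ t, WickIto.InDomT m (WickIto.indicatorL2 t) := fun t =>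
      WickIto.inDomT_indicatorL2 hm_meas hm_nonneg t (hm_cov t t)
    rw [WickIto.chaosCoeff_X_sub hP (hdom _) (hdom _) hint,
      WickIto.wick_firstChaos_integral _ hopc]
    rfl
  · rw [sub_sub_cancel]
    exact hS _ hEle hES
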